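/- Graphs are finite and simple. For a (possibly infinite) family $\mathcal F$ of graphs and a graph $G$ on $n$ vertices, let $E_{\mathcal F}(G)$ be the minimum of $\Delta(G,G')/n^2$ over all graphs $G'$ on the same vertex set that contain no member of $\mathcal F$ as a (not necessarily induced) subgraph, where $\Delta(G,G')$ is the number of edge additions and deletions turning $G$ into $G'$. For a weighted complete graph $W$ on $k$ vertices with edge weights $w(i,j)\in[0,1]$, let $\mathcal H_{\mathcal F}(W)$ be $1/k^2$ times the minimum total weight of a set of edges whose removal from the complete graph leaves a graph $K$ such that no $F\in\mathcal F$ has a homomorphism to $K$. (A minimum over the empty set is $+\infty$; this concerns only families containing an edgeless graph.) For nonempty disjoint vertex sets $A,B$ let $d(A,B)=e(A,B)/(|A||B|)$; the pair $(A,B)$ is $\gamma$-regular if $|d(A',B')-d(A,B)|\le\gamma$ for all $A'\subseteq A$, $B'\subseteq B$ with $|A'|\ge\gamma|A|$, $|B'|\ge\gamma|B|$. An equipartition is a partition of the vertex set into nonempty parts whose sizes pairwise differ by at most $1$. For $\mathcal E:\mathbb N\to(0,1)$, equipartitions $\mathcal A=\{V_i: 1\le i\le k\}$ and $\mathcal B=\{V_{i,j}: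 1\le i\le k,\ 1\le j\le l\}$ with $V_{i,j}\subseteq V_i$ form an $\mathcal E$-regular pair if 1. for all $1\le i<i'\le k$, all but at most $\mathcal E(k)l^2$ of the pairs $(j,j')\in\{1,\dots,l\}^2$ are such that $(V_{i,j},V_{i',j'})$ is $\mathcal E(k)$-regular; and 2. all but at most $\mathcal E(0)\binom k2$ of the pairs $1\le i<i'\le k$ are such that $|d(V_i,V_{i'})-d(V_{i,j},V_{i',j'})|<\mathcal E(0)$ for all but at most $\mathcal E(0)l^2$ of the pairs $(j,j')\in\{1,\dots,l\}^2$. **Lemma.** For every $\epsilon>0$ and every family of graphs $\mathcal F$ there are functions $N:\mathbb N\to\mathbb N$ and $\mathcal E:\mathbb N\to(0,1)$ with the following property. Suppose that a graph $G$ has an $\mathcal E$-regular pair of equipartitions $\mathcal A=\{V_i: 1\le i\le k\}$, $\mathcal B=\{V_{i,j}: 1\le i\le k,\ 1\le j\le l\}$ such that $k\ge 1/\epsilon$ and $|V_{i,j}|\ge N(k)$ for all $i,j$. Let $W$ be the weighted complete graph on $\{1,\dots,k\}$ with $w(i,j)=d(V_i,V_j)$ for $i\ne j$. Then $$|E_{\mathcal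 F}(G)-\mathcal H_{\mathcal F}(W)|\le\epsilon,$$ that is, $E_{\mathcal F}(G)\le\mathcal H_{\mathcal F}(W)+\epsilon$ and $\mathcal H_{\mathcal F}(W)\le E_{\mathcal F}(G)+\epsilon$ (where both quantities may be $+\infty$). -/

import Mathlib

universe u v

namespace EdgeDeletion

/-- A (possibly infinite) family of finite graphs, each given on a vertex set `{0, …, n - 1}`. -/
abbrev GraphFamily := Set (Σ n : ℕ, SimpleGraph (Fin n))

/-- `G` contains no member of `𝓕` as a (not necessarily induced) subgraph. -/
def FamilyFree (𝓕 : GraphFamily) {α : Type u} (G : SimpleGraph α) : Prop :=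
  ∀ F ∈ 𝓕, F.2.Free G

/-- No member of `𝓕` has a homomorphism into `K`. -/
def FamilyHomFree (𝓕 : GraphFamily) {V : Type v} (K : SimpleGraph V) : Prop :=
  ∀ F ∈ 𝓕, ¬ Nonempty (F.2 →g K)

/-- The edit distance: the number of edge additions and deletions that turn `G` into `G'`. -/
noncomputable def editDist {α : Type u} (G G' : SimpleGraph α) : ℕ :=
  (symmDiff G.edgeSet G'.edgeSet).ncard

/-- The normalized edit distance of `G` to the property `P` of graphs on the same `n` vertices:
the minimum of `Δ(G, G') / n ^ 2` over all `G'` satisfying `P`. The minimum over the empty set is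
`⊤`; otherwise the infimum is over a finite nonempty set of reals and is attained. -/
noncomputable def normEditDist {α : Type u} [Fintype α] (P : SimpleGraph α → Prop)
    (G : SimpleGraph α) : EReal :=
  ⨅ (G' : SimpleGraph α) (_ : P G'),
    (((editDist G G' : ℝ) / (Fintype.card α : ℝ) ^ 2 : ℝ) : EReal)

/-- `E_𝓕(G)`: the normalized edit distance of `G` to being `𝓕`-free. -/
noncomputable def editDistFree (𝓕 : GraphFamily) {α : Type u} [Fintype α]
    (G : SimpleGraph α) : EReal :=
  normEditDist (FamilyFree 𝓕) G

/-- A weighted complete graph: a weight in `[0, 1]` for every edge. The values of `weight` on the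
diagonal carry no meaning and are not used. -/
structure WeightedCompleteGraph (V : Type v) where
  weight : V → V → ℝ
  symm : ∀ i j, weight i j = weight j i
  mem_Icc : ∀ i j, i ≠ j → weight i j ∈ Set.Icc (0 : ℝ) 1

/-- The weight of an edge, as an unordered pair. -/
def WeightedCompleteGraph.edgeWeight {V : Type v} (W : WeightedCompleteGraph V) : Sym2 V → ℝ :=
  Sym2.lift ⟨W.weight, W.symm⟩

/-- `H_𝓕(W)`: the minimum, over all sets `S` of edges of the complete graph on the `k` vertices
of `W` whose removal leaves a graph into which no member of `𝓕` has a homomorphism, of the total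
weight of `S`, divided by `k ^ 2`. The minimum over the empty set is `⊤`. -/
noncomputable def homDist (𝓕 : GraphFamily) {V : Type v} [Fintype V]
    (W : WeightedCompleteGraph V) : EReal :=
  ⨅ (S : Finset (Sym2 V)) (_ : (S : Set (Sym2 V)) ⊆ (⊤ : SimpleGraph V).edgeSet)
    (_ : FamilyHomFree 𝓕 ((⊤ : SimpleGraph V).deleteEdges (S : Set (Sym2 V)))),
    (((∑ e ∈ S, W.edgeWeight e) / (Fintype.card V : ℝ) ^ 2 : ℝ) : EReal)

/-- The pair `(A, B)` is `γ`-regular in `G`. -/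
def IsRegularPair {α : Type u} (G : SimpleGraph α) [DecidableRel G.Adj] (γ : ℝ)
    (A B : Finset α) : Prop :=
  ∀ A' B' : Finset α, A' ⊆ A → B' ⊆ B →
    γ * (A.card : ℝ) ≤ (A'.card : ℝ) → γ * (B.card : ℝ) ≤ (B'.card : ℝ) →
    |(G.edgeDensity A' B' : ℝ) - (G.edgeDensity A B : ℝ)| ≤ γ

/-- The sets `V i` form a partition of the vertex set into nonempty parts, any two of which differ
in size by at most one. -/
structure IsEquipartition {ι : Type v} {α : Type u} (V : ι → Finset α) : Prop where
  nonempty : ∀ i, (V i).Nonempty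
  disjoint : ∀ i j, i ≠ j → Disjoint (V i) (V j)
  cover : ∀ x, ∃ i, x ∈ V i
  card_le : ∀ i j, (V i).card ≤ (V j).card + 1

/-- The equipartition `A = {V i}` of order `k` and its refinement `B = {U i j}` of order `k * l`,
where `U i j ⊆ V i`, form an `ℰ`-regular pair for the graph `G`. -/
structure IsRegularEquipartitionPair {α : Type u} (G : SimpleGraph α) [DecidableRel G.Adj]
    (ℰ : ℕ → ℝ) {k l : ℕ} (V : Fin k → Finset α) (U : Fin k → Fin l → Finset α) : Prop where
  equipartition : IsEquipartition V
  equipartition_refinement : IsEquipartition (fun p : Fin k × Fin l => U p.1 p.2)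
  subset : ∀ i j, U i j ⊆ V i
  regular : ∀ i i' : Fin k, i < i' →
    ({p : Fin l × Fin l | ¬ IsRegularPair G (ℰ k) (U i p.1) (U i' p.2)}.ncard : ℝ)
      ≤ ℰ k * (l : ℝ) ^ 2
  density : ({q : Fin k × Fin k | q.1 < q.2 ∧
      ¬ (({p : Fin l × Fin l |
            ¬ |(G.edgeDensity (V q.1) (V q.2) : ℝ)
                - (G.edgeDensity (U q.1 p.1) (U q.2 p.2) : ℝ)| < ℰ 0}.ncard : ℝ)
          ≤ ℰ 0 * (l : ℝ) ^ 2)}.ncard : ℝ)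
      ≤ ℰ 0 * (k.choose 2 : ℝ)

end EdgeDeletion

/-! For `E ≤ H + ε`, delete from `G` all edges inside parts and all edges between parts whose index
pair is removed from `W`. The part map is then a homomorphism to a graph that receives no member of
the family. Edges inside parts are few because `k ≥ 1/ε`.

For the converse, let `G'` be free of the family. The given partitions are regular for `G` but say
nothing about `G'`, so some regularity for `G'` has to be created inside them. Averaging selects one
cell per part (`exists_transversal`) so that all selected pairs are regular for `G`, few densities
deviate, and the total density of `G \ G'` is about average. Inside these cells, minimizing a
potential (density of `G \ G'`, minus a small multiple of the squared density of `G'`, minus a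
multiple of the log-sizes) produces subsets whose dense `G'`-pairs are lower regular, while the
density of `G \ G'` hardly grows (`exists_lower_regular`). Greedy embedding then shows that the
graph of dense `G'`-pairs receives no homomorphism from the family. On any other pair `G'` is
sparse, so the density of `G`, and with it the weight unless the pair deviates, is almost entirely
accounted for by `G \ G'`. Removing those pairs bounds `H`.

The retained fraction of each cell depends only on `k`, `ε` and the family, so `ℰ k` and `N k` can
be chosen in advance. An infinite family does no harm: there are finitely many graphs on `k`
vertices, and one obstructing member for each is enough. -/

namespace EdgeDeletion

/-! ### Lower regular subsets by minimizing a potential -/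

section Potential

variable {α : Type u} {ι : Type v}

/-- The average of `f` over `A × B` (zero if one of the sets is empty). -/
noncomputable def dens (f : α → α → ℝ) (A B : Finset α) : ℝ :=
  (∑ a ∈ A, ∑ b ∈ B, f a b) / ((A.card : ℝ) * B.card)

lemma dens_comm {f : α → α → ℝ} (hf : ∀ a b, f a b = f b a) (A B : Finset α) :
    dens f A B = dens f B A := by
  unfold dens
  rw [Finset.sum_comm, mul_comm]
  simp_rw [hf]

lemma dens_nonneg {f : α → α → ℝ} (hf : ∀ a b, 0 ≤ f a b) (A B : Finset α) :
    0 ≤ dens f A B :=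
  div_nonneg (Finset.sum_nonneg fun _ _ => Finset.sum_nonneg fun _ _ => hf _ _) (by positivity)

lemma dens_le_one {f : α → α → ℝ} (hf : ∀ a b, f a b ≤ 1) (A B : Finset α) :
    dens f A B ≤ 1 := by
  refine div_le_one_of_le₀ ?_ (by positivity)
  calc ∑ a ∈ A, ∑ b ∈ B, f a b ≤ ∑ a ∈ A, ∑ b ∈ B, (1 : ℝ) :=
        Finset.sum_le_sum fun _ _ => Finset.sum_le_sum fun _ _ => hf _ _
    _ = _ := by simp

lemma card_mul_dens (f : α → α → ℝ) (A B : Finset α) :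
    (A.card : ℝ) * dens f A B = (∑ a ∈ A, ∑ b ∈ B, f a b) / B.card := by
  unfold dens
  rcases A.eq_empty_or_nonempty with rfl | hA
  · simp
  · have : (A.card : ℝ) ≠ 0 := by exact_mod_cast hA.card_pos.ne'
    rw [← mul_div_assoc, mul_div_mul_left _ _ this]

lemma dens_split [DecidableEq α] (f : α → α → ℝ) {X A : Finset α} (h : X ⊆ A) (B : Finset α) :
    (X.card : ℝ) * dens f X B + ((A \ X).card : ℝ) * dens f (A \ X) B = A.card * dens f A B := by
  simp only [card_mul_dens]
  rw [← add_div, add_comm, Finset.sum_sdiff h]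

/-- The summand of the potential that belongs to one pair of sets. -/
noncomputable def pairPotential (f h : α → α → ℝ) (c : ℝ) (A B : Finset α) : ℝ :=
  dens f A B - c * dens h A B ^ 2

/-- Densities over `A` are size-weighted means of those over `X` and `A \ X`. Hence the `f` term is
preserved, while the mean square of the `h` term grows by the variance, of which only the share of
`X` is kept. -/
lemma pairPotential_split [DecidableEq α] (f h : α → α → ℝ) {c : ℝ} (hc : 0 ≤ c)
    {X A : Finset α} (hX : X ⊆ A) (B : Finset α) :
    (X.card : ℝ) * pairPotential f h c X B + ((A \ X).card : ℝ) * pairPotential f h c (A \ X) B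
      ≤ A.card * pairPotential f h c A B - c * X.card * (dens h X B - dens h A B) ^ 2 := by
  have h1 := dens_split f hX B
  have h2 := dens_split h hX B
  have h3 : (X.card : ℝ) + ((A \ X).card : ℝ) = A.card := by
    have := Finset.card_sdiff_add_card_eq_card hX
    rw [add_comm]; exact_mod_cast this
  have hY : (0 : ℝ) ≤ ((A \ X).card : ℝ) := by positivity
  unfold pairPotential
  generalize dens f X B = fx at *
  generalize dens f (A \ X) B = fy at *
  generalize dens f A B = fa at *
  generalize dens h X B = x at *
  generalize dens h (A \ X) B = y at *
  generalize dens h A B = a at *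
  generalize ((A \ X).card : ℝ) = m at *
  generalize (X.card : ℝ) = n at *
  rw [← h3] at h1 h2 ⊢
  have key : n * x ^ 2 + m * y ^ 2 = (n + m) * a ^ 2 + n * (x - a) ^ 2 + m * (y - a) ^ 2 := by
    linear_combination (2 * a) * h2
  have : 0 ≤ c * (m * (y - a) ^ 2) := by positivity
  have key' : c * (n * x ^ 2 + m * y ^ 2) =
    c * ((n + m) * a ^ 2 + n * (x - a) ^ 2 + m * (y - a) ^ 2) := by rw [key]
  nlinarith

lemma pairPotential_comm {f h : α → α → ℝ} (hf : ∀ a b, f a b = f b a)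
    (hh : ∀ a b, h a b = h b a) (c : ℝ) (A B : Finset α) :
    pairPotential f h c A B = pairPotential f h c B A := by
  unfold pairPotential
  rw [dens_comm hf, dens_comm hh]

/-- The potential that is minimized in order to find regular pairs. -/
noncomputable def potential [Fintype ι] (P : Finset (ι × ι)) (f h : α → α → ℝ) (c t : ℝ)
    (W : ι → Finset α) : ℝ :=
  ∑ p ∈ P, pairPotential f h c (W p.1) (W p.2) - t * ∑ i, Real.log (W i).card

lemma pairPotential_update [DecidableEq α] [DecidableEq ι] {f h : α → α → ℝ}
    (hf : ∀ a b, f a b = f b a) (hh : ∀ a b, h a b = h b a) {c : ℝ} (hc : 0 ≤ c)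
    (W : ι → Finset α) (i : ι) {X : Finset α} (hX : X ⊆ W i) {p q : ι} (hpq : p ≠ q) :
    (X.card : ℝ) * pairPotential f h c (Function.update W i X p) (Function.update W i X q)
      + ((W i \ X).card : ℝ) * pairPotential f h c (Function.update W i (W i \ X) p)
          (Function.update W i (W i \ X) q)
      ≤ (W i).card * pairPotential f h c (W p) (W q)
        - c * X.card * (dens h (Function.update W i X p) (Function.update W i X q)
            - dens h (W p) (W q)) ^ 2 := by
  by_cases hp : p = i
  · subst hp
    simp only [Function.update_self, Function.update_of_ne hpq.symm]
    exact pairPotential_split f h hc hX _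
  by_cases hq : q = i
  · subst hq
    simp only [Function.update_self, Function.update_of_ne hpq]
    rw [pairPotential_comm hf hh, pairPotential_comm hf hh c _ (W q \ X),
      pairPotential_comm hf hh c _ (W q), dens_comm hh, dens_comm hh _ (W q)]
    exact pairPotential_split f h hc hX _
  · simp only [Function.update_of_ne hp, Function.update_of_ne hq]
    have h3 : (X.card : ℝ) + ((W i \ X).card : ℝ) = (W i).card := by
      have := Finset.card_sdiff_add_card_eq_card hX
      rw [add_comm]; exact_mod_cast this
    rw [← h3]
    simp [add_mul]

/-- This is `log y ≤ y - 1` at `y = a / x`. For two pieces of sizes adding up to `a` the right-hand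
sides sum to `a`, so a split costs the log term at most `t` on average, however unequal the pieces.
-/
lemma mul_log_sub_le (x a : ℝ) (hx : 0 ≤ x) (ha : 0 < a) (hxa : x ≤ a) :
    x * (Real.log a - Real.log x) ≤ a - x := by
  rcases hx.eq_or_lt with rfl | hx
  · simpa using ha.le
  · rw [← Real.log_div ha.ne' hx.ne']
    have := Real.log_le_sub_one_of_pos (div_pos ha hx)
    calc x * Real.log (a / x) ≤ x * (a / x - 1) := by gcongr
      _ = a - x := by field_simp

/-- Cutting one set loses at most `t` through the logarithms and gains the variance of every pair;
the gain of `r` alone is kept, the others being nonnegative. -/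
lemma potential_update [Fintype ι] [DecidableEq α] [DecidableEq ι] {P : Finset (ι × ι)}
    (hP : ∀ p ∈ P, p.1 ≠ p.2) {f h : α → α → ℝ}
    (hf : ∀ a b, f a b = f b a) (hh : ∀ a b, h a b = h b a) {c t : ℝ} (hc : 0 ≤ c) (ht : 0 ≤ t)
    (W : ι → Finset α) (i : ι) (hW : (W i).Nonempty) {X : Finset α} (hX : X ⊆ W i)
    {r : ι × ι} (hr : r ∈ P) :
    (X.card : ℝ) * potential P f h c t (Function.update W i X)
      + ((W i \ X).card : ℝ) * potential P f h c t (Function.update W i (W i \ X))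
      ≤ (W i).card * (potential P f h c t W + t)
        - c * X.card * (dens h (Function.update W i X r.1) (Function.update W i X r.2)
            - dens h (W r.1) (W r.2)) ^ 2 := by
  have h3 : (X.card : ℝ) + ((W i \ X).card : ℝ) = (W i).card := by
    have := Finset.card_sdiff_add_card_eq_card hX
    rw [add_comm]; exact_mod_cast this
  have hA : (0 : ℝ) < (W i).card := by exact_mod_cast hW.card_pos
  have hpairs := Finset.sum_le_sum fun p hp =>
    pairPotential_update hf hh hc W i hX (hP p hp)
  rw [Finset.sum_add_distrib, Finset.sum_sub_distrib, ← Finset.mul_sum, ← Finset.mul_sum,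
    ← Finset.mul_sum, ← Finset.mul_sum] at hpairs
  have hgain : c * X.card * (dens h (Function.update W i X r.1) (Function.update W i X r.2)
            - dens h (W r.1) (W r.2)) ^ 2 ≤
      c * X.card * ∑ p ∈ P, (dens h (Function.update W i X p.1) (Function.update W i X p.2)
            - dens h (W p.1) (W p.2)) ^ 2 := by
    gcongr
    exact Finset.single_le_sum (f := fun p : ι × ι =>
      (dens h (Function.update W i X p.1) (Function.update W i X p.2)
            - dens h (W p.1) (W p.2)) ^ 2) (fun _ _ => sq_nonneg _) hr
  have hlog : ∀ Z : Finset α, ∑ j, Real.log (Function.update W i Z j).card =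
      ∑ j, Real.log (W j).card - Real.log (W i).card + Real.log Z.card := by
    intro Z
    rw [← Finset.add_sum_erase _ _ (Finset.mem_univ i),
      ← Finset.add_sum_erase (a := i) _ (fun j => Real.log ((W j).card : ℝ)) (Finset.mem_univ i)]
    rw [Finset.sum_congr rfl fun j hj => by
      rw [Function.update_of_ne (Finset.ne_of_mem_erase hj)]]
    simp only [Function.update_self]
    ring
  have hl1 := mul_log_sub_le X.card (W i).card (by positivity) hA
    (by exact_mod_cast Finset.card_le_card hX)
  have hl2 := mul_log_sub_le (W i \ X).card (W i).card (by positivity) hA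
    (by exact_mod_cast Finset.card_le_card Finset.sdiff_subset)
  unfold potential
  rw [hlog, hlog]
  generalize ∑ j, Real.log ((W j).card : ℝ) = L at *
  generalize Real.log ((W i).card : ℝ) = La at *
  generalize Real.log (X.card : ℝ) = Lx at *
  generalize Real.log ((W i \ X).card : ℝ) = Ly at *
  generalize ((W i \ X).card : ℝ) = m at *
  generalize (X.card : ℝ) = n at *
  have := mul_le_mul_of_nonneg_left (add_le_add hl1 hl2) ht
  rw [← h3] at this hpairs ⊢
  linarith

/-- Inside any tuple of nonempty sets there is a tuple of subsets, not much smaller, such that all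
its dense pairs are lower regular for `h`, and the total `f`-density has not increased much. -/
theorem exists_lower_regular [Fintype α] [Fintype ι] {P : Finset (ι × ι)}
    (hP : ∀ p ∈ P, p.1 ≠ p.2) {f h : α → α → ℝ}
    (hf : ∀ a b, f a b = f b a) (hh : ∀ a b, h a b = h b a)
    (hf0 : ∀ a b, 0 ≤ f a b) (hf1 : ∀ a b, f a b ≤ 1)
    (hh0 : ∀ a b, 0 ≤ h a b) (hh1 : ∀ a b, h a b ≤ 1)
    {c t γ δ : ℝ} (hc : 0 < c) (ht : 0 < t) (hγ : 0 < γ)  (hδ : 0 < δ)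
    (htγ : t * (1 + 1 / γ) < c * γ * (δ / 4) ^ 2)
    (U : ι → Finset α) (hU : ∀ i, (U i).Nonempty) :
    ∃ W : ι → Finset α, (∀ i, W i ⊆ U i) ∧ (∀ i, (W i).Nonempty) ∧
      (∀ i, Real.exp (-((1 + c) * P.card / t)) * (U i).card ≤ (W i).card) ∧
      ∑ p ∈ P, dens f (W p.1) (W p.2) ≤ ∑ p ∈ P, dens f (U p.1) (U p.2) + c * P.card ∧
      ∀ p ∈ P, δ ≤ dens h (W p.1) (W p.2) → ∀ A B : Finset α, A ⊆ W p.1 → B ⊆ W p.2 →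
        γ * (W p.1).card ≤ A.card → γ * (W p.2).card ≤ B.card → δ / 2 ≤ dens h A B := by
  classical
  obtain ⟨W, hW, hmin⟩ := Finset.exists_min_image
    (Finset.univ.filter fun W : ι → Finset α => ∀ i, W i ⊆ U i ∧ (W i).Nonempty)
    (potential P f h c t) ⟨U, by simp [hU]⟩
  simp only [Finset.mem_filter, Finset.mem_univ, true_and] at hW hmin
  have hUW := hmin U fun i => ⟨subset_rfl, hU i⟩
  have hlog : ∀ i, Real.log (W i).card ≤ Real.log (U i).card := fun i =>
    Real.log_le_log (by exact_mod_cast (hW i).2.card_pos)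
      (by exact_mod_cast Finset.card_le_card (hW i).1)
  have hsq : ∀ A B, 0 ≤ c * dens h A B ^ 2 := fun A B => by positivity
  have hsq1 : ∀ A B, c * dens h A B ^ 2 ≤ c := fun A B => by
    have := pow_le_one₀ (n := 2) (dens_nonneg hh0 A B) (dens_le_one hh1 A B)
    nlinarith
  unfold potential at hUW
  refine ⟨W, fun i => (hW i).1, fun i => (hW i).2, fun i => ?_, ?_, ?_⟩
  -- Every pair potential lies in `[-c, 1]`, so the total loss of log-size is at most `(1 + c) |P| /
  -- t`. The losses are nonnegative, so each single one obeys this bound.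
  · have h1 : ∑ p ∈ P, pairPotential f h c (U p.1) (U p.2) ≤ ∑ p ∈ P, (1 : ℝ) :=
      Finset.sum_le_sum fun p _ => by
        unfold pairPotential
        linarith [dens_le_one hf1 (U p.1) (U p.2), hsq (U p.1) (U p.2)]
    have h2 : ∑ p ∈ P, (-c) ≤ ∑ p ∈ P, pairPotential f h c (W p.1) (W p.2) :=
      Finset.sum_le_sum fun p _ => by
        unfold pairPotential
        linarith [dens_nonneg hf0 (W p.1) (W p.2), hsq1 (W p.1) (W p.2)]
    simp only [Finset.sum_const, nsmul_eq_mul, mul_one] at h1 h2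
    have h3 : Real.log (U i).card - Real.log (W i).card ≤
        ∑ j, (Real.log (U j).card - Real.log (W j).card) :=
      Finset.single_le_sum (f := fun j => Real.log ((U j).card : ℝ) - Real.log ((W j).card : ℝ))
        (fun j _ => sub_nonneg.2 (hlog j)) (Finset.mem_univ i)
    rw [Finset.sum_sub_distrib] at h3
    have h4 : t * (Real.log (U i).card - Real.log (W i).card) ≤ (1 + c) * P.card := by
      nlinarith
    have h5 : Real.log (U i).card - Real.log (W i).card ≤ (1 + c) * P.card / t := by
      rw [le_div_iff₀ ht]; linarith
    have hu : (0 : ℝ) < (U i).card := by exact_mod_cast (hU i).card_pos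
    have hw : (0 : ℝ) < (W i).card := by exact_mod_cast (hW i).2.card_pos
    calc Real.exp (-((1 + c) * P.card / t)) * (U i).card
        = Real.exp (-((1 + c) * P.card / t) + Real.log (U i).card) := by
          rw [Real.exp_add, Real.exp_log hu]
      _ ≤ Real.exp (Real.log (W i).card) := Real.exp_le_exp.2 (by linarith)
      _ = _ := Real.exp_log hw
  · have h1 : ∑ p ∈ P, pairPotential f h c (U p.1) (U p.2) ≤ ∑ p ∈ P, dens f (U p.1) (U p.2) :=
      Finset.sum_le_sum fun p _ => by
        unfold pairPotential
        linarith [hsq (U p.1) (U p.2)]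
    have h2 : ∑ p ∈ P, (dens f (W p.1) (W p.2) - c) ≤
        ∑ p ∈ P, pairPotential f h c (W p.1) (W p.2) :=
      Finset.sum_le_sum fun p _ => by
        unfold pairPotential
        linarith [hsq1 (W p.1) (W p.2)]
    rw [Finset.sum_sub_distrib] at h2
    simp only [Finset.sum_const, nsmul_eq_mul] at h2
    have h3 : t * ∑ i, Real.log (W i).card ≤ t * ∑ i, Real.log (U i).card :=
      mul_le_mul_of_nonneg_left (Finset.sum_le_sum fun i _ => hlog i) ht.le
    linarith
  · rintro ⟨p, q⟩ hpq hd A B hA hB hAc hBc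
    by_contra! hlt
    simp only at *
    have hne : p ≠ q := hP _ hpq
    have hwp : (0 : ℝ) < (W p).card := by exact_mod_cast (hW p).2.card_pos
    have hwq : (0 : ℝ) < (W q).card := by exact_mod_cast (hW q).2.card_pos
    have ha : (0 : ℝ) < A.card := lt_of_lt_of_le (by positivity) hAc
    have hb : (0 : ℝ) < B.card := lt_of_lt_of_le (by positivity) hBc
    have hAne : A.Nonempty := Finset.card_pos.1 (by exact_mod_cast ha)
    have hBne : B.Nonempty := Finset.card_pos.1 (by exact_mod_cast hb)
    -- The factor `X.card` admits the empty set, which is not a candidate in the minimization.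
    have hmin1 : ∀ X ⊆ W p, (X.card : ℝ) * potential P f h c t W ≤
        X.card * potential P f h c t (Function.update W p X) := by
      intro X hX
      rcases X.eq_empty_or_nonempty with rfl | hXne
      · simp
      refine mul_le_mul_of_nonneg_left (hmin _ fun j => ?_) (by positivity)
      by_cases hj : j = p
      · subst hj; simpa using ⟨hX.trans (hW _).1, hXne⟩
      · simpa [hj] using hW j
    have hmin2 : ∀ X ⊆ W q, (X.card : ℝ) * potential P f h c t W ≤
        X.card * potential P f h c t (Function.update (Function.update W p A) q X) := by
      intro X hX
      rcases X.eq_empty_or_nonempty with rfl | hXne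
      · simp
      refine mul_le_mul_of_nonneg_left (hmin _ fun j => ?_) (by positivity)
      by_cases hj : j = q
      · subst hj; simpa using ⟨hX.trans (hW _).1, hXne⟩
      by_cases hj' : j = p
      · subst hj'; simpa [hj] using ⟨hA.trans (hW _).1, hAne⟩
      · simpa [hj, hj'] using hW j
    have hsplit1 := potential_update hP hf hh hc.le ht.le W p (hW p).2 hA hpq
    have hWq : Function.update W p A q = W q := Function.update_of_ne hne.symm _ _
    have hsplit2 := potential_update hP hf hh hc.le ht.le (Function.update W p A) q
      (by rw [hWq]; exact (hW q).2) (X := B) (by rw [hWq]; exact hB) hpq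
    simp only [hWq, Function.update_self, Function.update_of_ne hne] at hsplit1 hsplit2
    have h1a := hmin1 A hA
    have h1b := hmin1 _ (Finset.sdiff_subset (s := W p) (t := A))
    have h2a := hmin2 B hB
    have h2b := hmin2 _ (Finset.sdiff_subset (s := W q) (t := B))
    have e1 : (A.card : ℝ) + ((W p \ A).card : ℝ) = (W p).card := by
      have := Finset.card_sdiff_add_card_eq_card hA
      rw [add_comm]; exact_mod_cast this
    have e2 : (B.card : ℝ) + ((W q \ B).card : ℝ) = (W q).card := by
      have := Finset.card_sdiff_add_card_eq_card hB
      rw [add_comm]; exact_mod_cast this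
    have htpos : t < c * γ * (δ / 4) ^ 2 := lt_of_le_of_lt (by
      have : 0 < t * (1 / γ) := by positivity
      linarith) htγ
    -- The density falls from at least `δ` to below `δ / 2` on the way from `(W p, W q)` over `(A, W
    -- q)` to `(A, B)`, so one of the two steps loses at least `δ / 4`. In the first case, cutting
    -- `W p` along `A` already beats the minimum.
    by_cases hcase : dens h A (W q) ≤ 3 / 4 * δ
    · have hgap : (δ / 4) ^ 2 ≤ (dens h A (W q) - dens h (W p) (W q)) ^ 2 := by
        rw [← neg_sq (dens h A (W q) - _)]
        exact pow_le_pow_left₀ (by positivity) (by linarith) 2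
      have : c * (γ * (W p).card) * (δ / 4) ^ 2 ≤
          c * A.card * (dens h A (W q) - dens h (W p) (W q)) ^ 2 := by gcongr
      have h6 : (W p).card * potential P f h c t W ≤ (A.card : ℝ) * potential P f h c t
        (Function.update W p A) + ((W p \ A).card : ℝ) *
          potential P f h c t (Function.update W p (W p \ A)) := by
        rw [← e1, add_mul]; linarith
      nlinarith
    · push Not at hcase
      have hgap : (δ / 4) ^ 2 ≤ (dens h A B - dens h A (W q)) ^ 2 := by
        rw [← neg_sq (dens h A B - _)]
        exact pow_le_pow_left₀ (by positivity) (by linarith) 2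
      have h5 : c * (γ * (W q).card) * (δ / 4) ^ 2 ≤
          c * B.card * (dens h A B - dens h A (W q)) ^ 2 := by gcongr
      have h6 : (W q).card * potential P f h c t W ≤ (B.card : ℝ) * potential P f h c t
        (Function.update (Function.update W p A) q B) + ((W q \ B).card : ℝ) *
          potential P f h c t (Function.update (Function.update W p A) q (W q \ B)) := by
        rw [← e2, add_mul]; linarith
      -- In the second case `W p` is first replaced by `A`, which raises the potential by at most `t
      -- / γ` because `W p \ A` cannot go below the minimum. Cutting `W q` along `B` costs a further
      -- `t`, and `htγ` says that the gain exceeds both.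
      have h7 : (A.card : ℝ) * potential P f h c t (Function.update W p A) ≤
          A.card * potential P f h c t W + t * (W p).card := by
        have : 0 ≤ c * (A.card : ℝ) * (dens h A (W q) - dens h (W p) (W q)) ^ 2 := by positivity
        rw [← e1] at hsplit1 ⊢
        nlinarith
      have h8 : potential P f h c t (Function.update W p A) ≤
          potential P f h c t W + t * (1 / γ) := by
        have : t * (W p).card ≤ A.card * (t * (1 / γ)) := by
          have : ((W p).card : ℝ) ≤ A.card * (1 / γ) := by
            rw [mul_one_div, le_div_iff₀ hγ]; linarith
          calc t * (W p).card ≤ t * (A.card * (1 / γ)) := by gcongr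
            _ = _ := by ring
        have : (A.card : ℝ) * potential P f h c t (Function.update W p A) ≤
          A.card * (potential P f h c t W + t * (1 / γ)) := by linarith
        exact le_of_mul_le_mul_left this ha
      have h9 : ((W q).card : ℝ) * potential P f h c t (Function.update W p A) ≤
          (W q).card * (potential P f h c t W + t * (1 / γ)) := by gcongr
      have h10 := mul_lt_mul_of_pos_left htγ hwq
      linarith

end Potential

/-! ### Greedy embedding -/

section Embedding

open Classical in
/-- The indicator function of adjacency. -/
noncomputable def adjInd {α : Type u} (G : SimpleGraph α) (a b : α) : ℝ :=
  if G.Adj a b then 1 else 0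

lemma adjInd_comm {α : Type u} (G : SimpleGraph α) (a b : α) : adjInd G a b = adjInd G b a := by
  by_cases h : G.Adj a b
  · simp [adjInd, h, h.symm]
  · simp [adjInd, h, mt (G.adj_symm (u := b) (v := a)) h]

lemma adjInd_nonneg {α : Type u} (G : SimpleGraph α) (a b : α) : 0 ≤ adjInd G a b := by
  unfold adjInd; split_ifs <;> norm_num

lemma adjInd_le_one {α : Type u} (G : SimpleGraph α) (a b : α) : adjInd G a b ≤ 1 := by
  unfold adjInd; split_ifs <;> norm_num

open Classical in
lemma sum_adjInd {α : Type u} (G : SimpleGraph α) (a : α) (B : Finset α) :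
    ∑ b ∈ B, adjInd G a b = (B.filter (G.Adj a)).card := by
  simp [adjInd]

open Classical in
/-- Greedy embedding: a graph on `m` vertices embeds along large sets any two of which, if they
correspond to adjacent vertices, are dense on all large subsets. -/
theorem exists_greedy_embedding {d : ℝ} (hd : 0 < d) (hd1 : d ≤ 1) (m : ℕ) :
    ∃ a : ℝ, 1 ≤ a ∧ ∀ {α : Type u} (F : SimpleGraph (Fin m)) (H : SimpleGraph α)
      (C : Fin m → Finset α) (s : Fin m → ℝ), (∀ v, 1 ≤ s v) → (∀ v, a * s v ≤ (C v).card) →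
      (∀ u v, F.Adj u v → ∀ A B, A ⊆ C u → B ⊆ C v → s u ≤ A.card → s v ≤ B.card →
        d ≤ dens (adjInd H) A B) →
      ∃ f : Fin m → α, Function.Injective f ∧ (∀ v, f v ∈ C v) ∧
        ∀ u v, F.Adj u v → H.Adj (f u) (f v) := by
  induction m with
  | zero => exact ⟨1, le_rfl, fun F H C s _ _ _ => ⟨fun v => v.elim0, fun v => v.elim0,
      fun v => v.elim0, fun v => v.elim0⟩⟩
  | succ m ih =>
    obtain ⟨a, ha, ih⟩ := ih
    have hm : (0 : ℝ) ≤ m := m.cast_nonneg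
    have hda : a + m + 2 ≤ (a + m + 2) / d := le_div_self (by linarith) hd hd1
    -- The factor `1 / d` pays for restricting to a neighbourhood, `m` for the bad vertices, and the
    -- rest for deleting the image of vertex `0`. The thresholds `s` stay fixed, so the density
    -- hypothesis passes to smaller candidate sets.
    refine ⟨(a + m + 2) / d, by linarith, fun {α} F H C s hs hC hdens => ?_⟩
    have hC1 : ∀ v, (a + m + 2) * s v ≤ (C v).card := fun v =>
      (mul_le_mul_of_nonneg_right hda (by linarith [hs v])).trans (hC v)
    have hC2 : ∀ v, (a + m + 2) * s v ≤ d * (C v).card := fun v => by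
      have := mul_le_mul_of_nonneg_left (hC v) hd.le
      rwa [← mul_assoc, mul_div_cancel₀ _ hd.ne'] at this
    have hsC : ∀ v, s v ≤ (C v).card := fun v => by
      refine le_trans ?_ (hC1 v)
      nlinarith [hs v]
    -- Vertices with too few neighbours in the candidate set of `v`. More than `s 0` of them would
    -- form a set of density below `d` towards it.
    set bad : Fin m → Finset α := fun v => if F.Adj 0 v.succ then
      (C 0).filter fun x => (((C v.succ).filter (H.Adj x)).card : ℝ) < d * (C v.succ).card else ∅
    have hbad : ∀ v, ((bad v).card : ℝ) ≤ s 0 := by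
      intro v
      by_cases hv : F.Adj 0 v.succ
      · by_contra! hlt
        have hcard : (0 : ℝ) < (bad v).card := by linarith [hs 0]
        have hcard' : (0 : ℝ) < (C v.succ).card := by linarith [hs v.succ, hsC v.succ]
        have hsub : bad v ⊆ C 0 := by
          dsimp only [bad]
          rw [if_pos hv]
          exact Finset.filter_subset _ _
        have := hdens 0 v.succ hv (bad v) (C v.succ) hsub subset_rfl hlt.le (hsC _)
        unfold dens at this
        rw [le_div_iff₀ (mul_pos hcard hcard')] at this
        have hlt' : ∑ x ∈ bad v, ∑ b ∈ C v.succ, adjInd H x b <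
            ∑ x ∈ bad v, d * (C v.succ).card := by
          refine Finset.sum_lt_sum_of_nonempty (Finset.card_pos.1 (by exact_mod_cast hcard)) ?_
          intro x hx
          dsimp only [bad] at hx
          rw [if_pos hv, Finset.mem_filter] at hx
          rw [sum_adjInd]
          exact hx.2
        simp only [Finset.sum_const, nsmul_eq_mul] at hlt'
        linarith
      · dsimp only [bad]
        rw [if_neg hv, Finset.card_empty, Nat.cast_zero]
        linarith [hs 0]
    obtain ⟨x, hx0, hx⟩ : ∃ x ∈ C 0, x ∉ Finset.univ.biUnion bad := by
      by_contra! hall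
      have h1 : (C 0).card ≤ ∑ v, (bad v).card :=
        (Finset.card_le_card hall).trans Finset.card_biUnion_le
      have h2 : ((C 0).card : ℝ) ≤ ∑ v, ((bad v).card : ℝ) := by exact_mod_cast h1
      have h3 : ∑ v, ((bad v).card : ℝ) ≤ ∑ v : Fin m, s 0 := Finset.sum_le_sum fun v _ => hbad v
      simp only [Finset.sum_const, nsmul_eq_mul, Finset.card_univ, Fintype.card_fin] at h3
      have := hC1 0
      nlinarith [hs 0]
    simp only [Finset.mem_biUnion, Finset.mem_univ, true_and, not_exists] at hx
    set D : Fin m → Finset α := fun v =>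
      (if F.Adj 0 v.succ then (C v.succ).filter (H.Adj x) else C v.succ).erase x
    have hDC : ∀ v, D v ⊆ C v.succ := by
      intro v
      refine (Finset.erase_subset _ _).trans ?_
      split_ifs
      · exact Finset.filter_subset _ _
      · exact subset_rfl
    have hDcard : ∀ v, a * s v.succ ≤ (D v).card := by
      intro v
      have h1 : ∀ S : Finset α, (S.card : ℝ) - 1 ≤ (S.erase x).card := by
        intro S
        have := Finset.pred_card_le_card_erase (s := S) (a := x)
        have : (S.card : ℝ) ≤ (S.erase x).card + 1 := by
          exact_mod_cast Nat.sub_le_iff_le_add.1 this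
        linarith
      refine le_trans ?_ (h1 _)
      have h2 : d * (C v.succ).card ≤
          (if F.Adj 0 v.succ then (C v.succ).filter (H.Adj x) else C v.succ).card := by
        split_ifs with hv
        · have := hx v
          dsimp only [bad] at this
          rw [if_pos hv, Finset.mem_filter, not_and, not_lt] at this
          exact this hx0
        · exact mul_le_of_le_one_left (by positivity) hd1
      have := hC2 v.succ
      nlinarith [hs v.succ]
    obtain ⟨f, hinj, hfD, hadj⟩ := ih (F.comap Fin.succ) H D (fun v => s v.succ)
      (fun v => hs _) hDcard fun u v huv A B hA hB =>
        hdens u.succ v.succ huv A B (hA.trans (hDC u)) (hB.trans (hDC v))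
    have hx_adj : ∀ v : Fin m, F.Adj 0 v.succ → H.Adj x (f v) := by
      intro v hv
      have := Finset.mem_of_mem_erase (hfD v)
      simp only [hv, if_true, Finset.mem_filter] at this
      exact this.2
    refine ⟨Fin.cons x f, Fin.cons_injective_iff.2 ⟨?_, hinj⟩, ?_, ?_⟩
    · rintro ⟨v, hv⟩
      exact Finset.ne_of_mem_erase (hfD v) hv
    · intro v
      cases v using Fin.cases with
      | zero => exact hx0
      | succ v => exact hDC v (hfD v)
    · intro u v huv
      cases u using Fin.cases with
      | zero =>
        cases v using Fin.cases with
        | zero => exact absurd huv (F.loopless.irrefl _)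
        | succ v => exact hx_adj v huv
      | succ u =>
        cases v using Fin.cases with
        | zero => exact (hx_adj u huv.symm).symm
        | succ v => exact hadj u v huv

end Embedding

/-! ### Averaging over transversals and double counting of edges -/

section Averaging

/-- Two distinct coordinates of a uniform `J` are uniform and independent: the sum is invariant
under translating them by `c` and `d`, and averaging over `c, d` makes it independent of `J`. -/
lemma sum_pi_apply_two {k l : ℕ} {p q : Fin k} (hpq : p ≠ q) (t : Fin l → Fin l → ℝ) :
    (l : ℝ) ^ 2 * ∑ J : Fin k → Fin l, t (J p) (J q) = (l : ℝ) ^ k * ∑ a, ∑ b, t a b := by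
  rcases l with _ | l
  · have : IsEmpty (Fin k → Fin 0) := ⟨fun J => (J p).elim0⟩
    simp
  have h1 : ∀ c d : Fin (l + 1), ∑ J : Fin k → Fin (l + 1), t (J p) (J q) =
      ∑ J : Fin k → Fin (l + 1), t (J p + c) (J q + d) := by
    intro c d
    rw [← Equiv.sum_comp (Equiv.addRight (Pi.single p c + Pi.single q d : Fin k → Fin (l + 1)))]
    simp [hpq, hpq.symm]
  have h2 : ∀ a b : Fin (l + 1), ∑ c, ∑ d, t (a + c) (b + d) = ∑ c, ∑ d, t c d := by
    intro a b
    rw [← Equiv.sum_comp (Equiv.addLeft a) fun c => ∑ d, t c d]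
    refine Finset.sum_congr rfl fun c _ => ?_
    exact Equiv.sum_comp (Equiv.addLeft b) fun d => t (a + c) d
  calc ((l + 1 : ℕ) : ℝ) ^ 2 * ∑ J : Fin k → Fin (l + 1), t (J p) (J q)
      = ∑ c : Fin (l + 1), ∑ d : Fin (l + 1), ∑ J : Fin k → Fin (l + 1), t (J p) (J q) := by
        simp [pow_two, mul_assoc]
    _ = ∑ c : Fin (l + 1), ∑ d : Fin (l + 1), ∑ J : Fin k → Fin (l + 1), t (J p + c) (J q + d) :=
        Finset.sum_congr rfl fun c _ => Finset.sum_congr rfl fun d _ => h1 c d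
    _ = ∑ J : Fin k → Fin (l + 1), ∑ c : Fin (l + 1), ∑ d : Fin (l + 1), t (J p + c) (J q + d) := by
        rw [Finset.sum_comm]
        rw [Finset.sum_congr rfl fun d _ => Finset.sum_comm]
        rw [Finset.sum_comm]
        exact Finset.sum_congr rfl fun J _ => Finset.sum_comm
    _ = _ := by
        simp_rw [h2]
        simp

lemma exists_sum_le_average {k l : ℕ} (hl : 0 < l) {P : Finset (Fin k × Fin k)}
    (hP : ∀ p ∈ P, p.1 ≠ p.2) (t : Fin k × Fin k → Fin l → Fin l → ℝ) :
    ∃ J : Fin k → Fin l, (l : ℝ) ^ 2 * ∑ p ∈ P, t p (J p.1) (J p.2) ≤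
      ∑ p ∈ P, ∑ a, ∑ b, t p a b := by
  have : NeZero l := ⟨hl.ne'⟩
  by_contra! hlt
  have h1 := Finset.sum_lt_sum_of_nonempty (s := (Finset.univ : Finset (Fin k → Fin l)))
    Finset.univ_nonempty fun J _ => hlt J
  have h2 : ∑ J : Fin k → Fin l, (l : ℝ) ^ 2 * ∑ p ∈ P, t p (J p.1) (J p.2) =
      (l : ℝ) ^ k * ∑ p ∈ P, ∑ a, ∑ b, t p a b := by
    rw [← Finset.mul_sum, Finset.sum_comm, Finset.mul_sum, Finset.mul_sum]
    exact Finset.sum_congr rfl fun p hp => sum_pi_apply_two (hP p hp) (t p)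
  rw [h2] at h1
  simp at h1

lemma sum_sum_adjInd {α : Type u} (G : SimpleGraph α) [DecidableRel G.Adj] (A B : Finset α) :
    ∑ x ∈ A, ∑ y ∈ B, adjInd G x y = ((G.interedges A B).card : ℝ) := by
  rw [← Finset.sum_product']
  simp only [adjInd, SimpleGraph.interedges, Rel.interedges, Finset.card_filter, Nat.cast_sum]
  refine Finset.sum_congr rfl fun z _ => ?_
  by_cases h : G.Adj z.1 z.2 <;> simp [h]

lemma edgeDensity_eq_dens {α : Type u} (G : SimpleGraph α) [DecidableRel G.Adj]
    (A B : Finset α) : (G.edgeDensity A B : ℝ) = dens (adjInd G) A B := by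
  unfold dens
  rw [sum_sum_adjInd, SimpleGraph.edgeDensity_def]
  push_cast
  rfl

/-- The hypothesis `hinj` lets each edge be counted for one index only, in either orientation;
disjointness of `A c` and `B c` excludes counting it twice there. -/
lemma sum_adjInd_le_ncard_edgeSet {α : Type u} [Fintype α] {κ : Type v} (D : SimpleGraph α)
    (Q : Finset κ) (A B : κ → Finset α) (hAB : ∀ c ∈ Q, Disjoint (A c) (B c))
    (hinj : ∀ c ∈ Q, ∀ c' ∈ Q, ∀ x ∈ A c, ∀ y ∈ B c,
      (x ∈ A c' ∧ y ∈ B c') ∨ (x ∈ B c' ∧ y ∈ A c') → c = c') :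
    ∑ c ∈ Q, ∑ x ∈ A c, ∑ y ∈ B c, adjInd D x y ≤ (D.edgeSet.ncard : ℝ) := by
  classical
  simp_rw [sum_sum_adjInd, SimpleGraph.interedges, Rel.interedges]
  rw [← SimpleGraph.coe_edgeFinset, Set.ncard_coe_finset]
  norm_cast
  rw [← Finset.card_sigma]
  refine Finset.card_le_card_of_injOn (fun z => s(z.2.1, z.2.2)) ?_ ?_
  · rintro ⟨c, x, y⟩ hz
    simp only [Finset.coe_sigma, Set.mem_sigma_iff, Finset.mem_coe, Finset.mem_filter] at hz
    simpa using hz.2.2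
  · rintro ⟨c, x, y⟩ hz ⟨c', x', y'⟩ hz' heq
    simp only [Finset.coe_sigma, Set.mem_sigma_iff, Finset.mem_coe, Finset.mem_filter,
      Finset.mem_product] at hz hz'
    obtain ⟨hc, ⟨hx, hy⟩, -⟩ := hz
    obtain ⟨hc', ⟨hx', hy'⟩, -⟩ := hz'
    simp only [Sym2.eq_iff] at heq
    rcases heq with ⟨rfl, rfl⟩ | ⟨rfl, rfl⟩
    · obtain rfl := hinj c hc c' hc' x hx y hy (Or.inl ⟨hx', hy'⟩)
      rfl
    · obtain rfl := hinj c hc c' hc' x hx y hy (Or.inr ⟨hy', hx'⟩)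
      exact absurd hy' (Finset.disjoint_left.1 (hAB c hc) hx)

/-- The pairs `(i, j)` with `i < j`. -/
def upperPairs (k : ℕ) : Finset (Fin k × Fin k) := Finset.univ.filter fun p => p.1 < p.2

lemma mem_upperPairs {k : ℕ} {p : Fin k × Fin k} : p ∈ upperPairs k ↔ p.1 < p.2 := by
  simp [upperPairs]

lemma card_upperPairs_le (k : ℕ) : ((upperPairs k).card : ℝ) ≤ (k : ℝ) ^ 2 := by
  have : (upperPairs k).card ≤ k ^ 2 := by
    refine (Finset.card_le_univ _).trans ?_
    simp [pow_two]
  exact_mod_cast this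

lemma sum_dens_le {α : Type u} [Fintype α] (D : SimpleGraph α) {k l m : ℕ} (hm : 0 < m)
    (U : Fin k → Fin l → Finset α)
    (hU : ∀ i j i' j', (i, j) ≠ (i', j') → Disjoint (U i j) (U i' j'))
    (hUm : ∀ i j, m ≤ (U i j).card) :
    ∑ p ∈ upperPairs k, ∑ a, ∑ b, dens (adjInd D) (U p.1 a) (U p.2 b) ≤
      (D.edgeSet.ncard : ℝ) / (m : ℝ) ^ 2 := by
  have hm' : (0 : ℝ) < m := by exact_mod_cast hm
  have heq : ∀ {x i j i' j'}, x ∈ U i j → x ∈ U i' j' → i = i' ∧ j = j' := by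
    intro x i j i' j' h h'
    by_contra hne
    exact Finset.disjoint_left.1 (hU i j i' j' (by simpa using hne)) h h'
  have h1 := sum_adjInd_le_ncard_edgeSet D
    (upperPairs k ×ˢ (Finset.univ : Finset (Fin l × Fin l)))
    (fun c => U c.1.1 c.2.1) (fun c => U c.1.2 c.2.2) ?_ ?_
  · rw [le_div_iff₀ (by positivity), Finset.sum_mul]
    refine le_trans (le_of_le_of_eq ?_ (Finset.sum_product _ _ _).symm) h1
    refine Finset.sum_le_sum fun p _ => ?_
    rw [← Finset.univ_product_univ, Finset.sum_product, Finset.sum_mul]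
    refine Finset.sum_le_sum fun a _ => ?_
    rw [Finset.sum_mul]
    refine Finset.sum_le_sum fun b _ => ?_
    have ha : (m : ℝ) ≤ (U p.1 a).card := by exact_mod_cast hUm _ _
    have hb : (m : ℝ) ≤ (U p.2 b).card := by exact_mod_cast hUm _ _
    have hnn := dens_nonneg (adjInd_nonneg D) (U p.1 a) (U p.2 b)
    calc dens (adjInd D) (U p.1 a) (U p.2 b) * (m : ℝ) ^ 2
        ≤ dens (adjInd D) (U p.1 a) (U p.2 b) * ((U p.1 a).card * (U p.2 b).card) := by
          rw [pow_two]; gcongr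
      _ = _ := by
          unfold dens
          rw [div_mul_cancel₀]
          have : (0 : ℝ) < (U p.1 a).card := by linarith
          have : (0 : ℝ) < (U p.2 b).card := by linarith
          positivity
  · rintro ⟨⟨p, q⟩, a, b⟩ hc
    simp only [Finset.mem_product, mem_upperPairs] at hc
    exact hU _ _ _ _ (by simp [hc.1.ne])
  · rintro ⟨⟨p, q⟩, a, b⟩ hc ⟨⟨p', q'⟩, a', b'⟩ hc' x hx y hy h
    simp only [Finset.mem_product, mem_upperPairs] at hc hc'
    rcases h with ⟨hx', hy'⟩ | ⟨hx', hy'⟩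
    · obtain ⟨rfl, rfl⟩ := heq hx hx'
      obtain ⟨rfl, rfl⟩ := heq hy hy'
      rfl
    · obtain ⟨rfl, -⟩ := heq hx hx'
      obtain ⟨rfl, -⟩ := heq hy hy'
      exact absurd hc.1 (lt_asymm hc'.1)

lemma sum_ite_one_eq_ncard {l : ℕ} (p : Fin l → Fin l → Prop) [∀ a b, Decidable (p a b)] :
    ∑ a, ∑ b, (if p a b then (1 : ℝ) else 0) = ({z : Fin l × Fin l | p z.1 z.2}.ncard : ℝ) := by
  rw [← Finset.sum_product', Finset.univ_product_univ, Finset.sum_boole, Set.ncard_eq_toFinset_card']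
  simp

/-- The densities of the pairs `(A, B)` and `(A', B')` differ by at least `γ`. -/
def DensityDeviates {α : Type u} (G : SimpleGraph α) (γ : ℝ) (A B A' B' : Finset α) : Prop :=
  ¬ |dens (adjInd G) A B - dens (adjInd G) A' B'| < γ

open Classical in
/-- One part of the refinement can be chosen in each part such that all the chosen pairs are
regular, few of their densities deviate, and their total density in `D` is about the average. -/
theorem exists_transversal {α : Type u} [Fintype α] {G D : SimpleGraph α} [DecidableRel G.Adj]
    {ℰ : ℕ → ℝ} {k l m : ℕ} {V : Fin k → Finset α} {U : Fin k → Fin l → Finset α}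
    (hreg : IsRegularEquipartitionPair G ℰ V U) (hl : 0 < l) (hm : 0 < m)
    (hUm : ∀ i j, m ≤ (U i j).card) (hℰ0 : 0 ≤ ℰ 0) (hℰk : 0 ≤ ℰ k)
    (hsmall : (D.edgeSet.ncard : ℝ) / ((l : ℝ) ^ 2 * (m : ℝ) ^ 2) + 2 * ℰ 0 * (k : ℝ) ^ 2
        + 2 * (k : ℝ) ^ 4 * ℰ k < 2 * (k : ℝ) ^ 2) :
    ∃ J : Fin k → Fin l,
      (∀ p ∈ upperPairs k, IsRegularPair G (ℰ k) (U p.1 (J p.1)) (U p.2 (J p.2))) ∧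
      ∑ p ∈ upperPairs k, (dens (adjInd D) (U p.1 (J p.1)) (U p.2 (J p.2)) +
        if DensityDeviates G (ℰ 0) (V p.1) (V p.2) (U p.1 (J p.1)) (U p.2 (J p.2)) then 1 else 0)
      ≤ (D.edgeSet.ncard : ℝ) / ((l : ℝ) ^ 2 * (m : ℝ) ^ 2) + 2 * ℰ 0 * (k : ℝ) ^ 2
        + 2 * (k : ℝ) ^ 4 * ℰ k := by
  have hlpos : (0 : ℝ) < (l : ℝ) ^ 2 := by positivity
  set d : Fin k × Fin k → Fin l → Fin l → ℝ := fun p a b =>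
    dens (adjInd D) (U p.1 a) (U p.2 b) with hd
  set bad : Fin k × Fin k → Fin l → Fin l → ℝ := fun p a b =>
    if DensityDeviates G (ℰ 0) (V p.1) (V p.2) (U p.1 a) (U p.2 b) then 1 else 0 with hbad
  set irr : Fin k × Fin k → Fin l → Fin l → ℝ := fun p a b =>
    if ¬ IsRegularPair G (ℰ k) (U p.1 a) (U p.2 b) then 1 else 0 with hirr
  have hcard := card_upperPairs_le k
  have hdsum : ∑ p ∈ upperPairs k, ∑ a, ∑ b, d p a b ≤
      (l : ℝ) ^ 2 * ((D.edgeSet.ncard : ℝ) / ((l : ℝ) ^ 2 * (m : ℝ) ^ 2)) := by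
    refine (sum_dens_le D hm U ?_ hUm).trans (le_of_eq ?_)
    · intro i j i' j' hne
      exact hreg.equipartition_refinement.disjoint (i, j) (i', j') hne
    · field_simp
  have hirrsum : ∑ p ∈ upperPairs k, ∑ a, ∑ b, irr p a b ≤ (l : ℝ) ^ 2 * ((k : ℝ) ^ 2 * ℰ k) := by
    calc ∑ p ∈ upperPairs k, ∑ a, ∑ b, irr p a b ≤ ∑ p ∈ upperPairs k, ℰ k * (l : ℝ) ^ 2 := by
          refine Finset.sum_le_sum fun p hp => ?_
          dsimp only [irr]
          rw [sum_ite_one_eq_ncard fun a b => ¬ IsRegularPair G (ℰ k) (U p.1 a) (U p.2 b)]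
          exact hreg.regular p.1 p.2 (mem_upperPairs.1 hp)
      _ = (upperPairs k).card * (ℰ k * (l : ℝ) ^ 2) := by simp
      _ ≤ (k : ℝ) ^ 2 * (ℰ k * (l : ℝ) ^ 2) := by gcongr
      _ = _ := by ring
  have hbadsum : ∑ p ∈ upperPairs k, ∑ a, ∑ b, bad p a b ≤
      (l : ℝ) ^ 2 * (2 * ℰ 0 * (k : ℝ) ^ 2) := by
    set T : Set (Fin k × Fin k) := {q : Fin k × Fin k | q.1 < q.2 ∧
      ¬ (({p : Fin l × Fin l | ¬ |(G.edgeDensity (V q.1) (V q.2) : ℝ)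
                - (G.edgeDensity (U q.1 p.1) (U q.2 p.2) : ℝ)| < ℰ 0}.ncard : ℝ)
          ≤ ℰ 0 * (l : ℝ) ^ 2)} with hT
    have hT1 : (T.ncard : ℝ) ≤ ℰ 0 * (k : ℝ) ^ 2 := by
      refine hreg.density.trans ?_
      gcongr
      exact_mod_cast Nat.choose_le_pow k 2
    -- An exceptional pair of parts may deviate on all `l ^ 2` choices, any other on at most `ℰ 0 *
    -- l ^ 2`. Both kinds contribute `ℰ 0 * k ^ 2` to the average.
    have hpt : ∀ p ∈ upperPairs k, ∑ a, ∑ b, bad p a b ≤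
        ℰ 0 * (l : ℝ) ^ 2 + (if p ∈ T then 1 else 0) * (l : ℝ) ^ 2 := by
      intro p hp
      by_cases hpT : p ∈ T
      · rw [if_pos hpT]
        have : ∑ a, ∑ b, bad p a b ≤ ∑ a : Fin l, ∑ b : Fin l, (1 : ℝ) :=
          Finset.sum_le_sum fun a _ => Finset.sum_le_sum fun b _ => by
            rw [hbad]; dsimp only; split_ifs <;> norm_num
        have h0 : 0 ≤ ℰ 0 * (l : ℝ) ^ 2 := by positivity
        simp only [Finset.sum_const, Finset.card_univ, Fintype.card_fin, nsmul_eq_mul,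
          mul_one] at this
        nlinarith
      · rw [if_neg hpT, hbad, sum_ite_one_eq_ncard]
        simp only [hT, Set.mem_ofPred_eq, not_and, not_not] at hpT
        have := hpT (mem_upperPairs.1 hp)
        simp only [edgeDensity_eq_dens] at this
        simpa [DensityDeviates] using this
    calc _ ≤ ∑ p ∈ upperPairs k, (ℰ 0 * (l : ℝ) ^ 2 + (if p ∈ T then 1 else 0) * (l : ℝ) ^ 2) :=
          Finset.sum_le_sum hpt
      _ = (upperPairs k).card * (ℰ 0 * (l : ℝ) ^ 2) +
          (∑ p ∈ upperPairs k, if p ∈ T then (1 : ℝ) else 0) * (l : ℝ) ^ 2 := by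
          rw [Finset.sum_add_distrib, Finset.sum_mul]; simp
      _ ≤ (k : ℝ) ^ 2 * (ℰ 0 * (l : ℝ) ^ 2) + (ℰ 0 * (k : ℝ) ^ 2) * (l : ℝ) ^ 2 := by
          gcongr
          refine le_trans ?_ hT1
          rw [Finset.sum_boole, Set.ncard_eq_toFinset_card']
          exact_mod_cast Finset.card_le_card fun p => by simp
      _ = _ := by ring
  -- The penalty `2 * k ^ 2` makes a single irregular pair exceed the bound `hsmall`, so the
  -- averaging choice has none.
  obtain ⟨J, hJ⟩ := exists_sum_le_average hl (P := upperPairs k)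
    (fun p hp => (mem_upperPairs.1 hp).ne) fun p a b => d p a b + bad p a b
      + 2 * (k : ℝ) ^ 2 * irr p a b
  simp only [Finset.sum_add_distrib, ← Finset.mul_sum] at hJ
  have hirr0 : ∀ p a b, 0 ≤ irr p a b := fun p a b => by
    rw [hirr]; dsimp only; split_ifs <;> norm_num
  have hJ' : ∑ p ∈ upperPairs k, d p (J p.1) (J p.2) + ∑ p ∈ upperPairs k, bad p (J p.1) (J p.2)
      + 2 * (k : ℝ) ^ 2 * ∑ p ∈ upperPairs k, irr p (J p.1) (J p.2) ≤
      (D.edgeSet.ncard : ℝ) / ((l : ℝ) ^ 2 * (m : ℝ) ^ 2) + 2 * ℰ 0 * (k : ℝ) ^ 2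
        + 2 * (k : ℝ) ^ 4 * ℰ k := by
    have h2 : 2 * (k : ℝ) ^ 2 * ∑ p ∈ upperPairs k, ∑ a, ∑ b, irr p a b ≤
      2 * (k : ℝ) ^ 2 * ((l : ℝ) ^ 2 * ((k : ℝ) ^ 2 * ℰ k)) := by gcongr
    refine le_of_mul_le_mul_left (hJ.trans ?_) hlpos
    linarith
  have hd0 : 0 ≤ ∑ p ∈ upperPairs k, d p (J p.1) (J p.2) :=
    Finset.sum_nonneg fun p _ => dens_nonneg (adjInd_nonneg D) _ _
  have hbad0 : 0 ≤ ∑ p ∈ upperPairs k, bad p (J p.1) (J p.2) :=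
    Finset.sum_nonneg fun p _ => by rw [hbad]; dsimp only; split_ifs <;> norm_num
  have hk0 : 0 ≤ 2 * (k : ℝ) ^ 2 * ∑ p ∈ upperPairs k, irr p (J p.1) (J p.2) :=
    mul_nonneg (by positivity) (Finset.sum_nonneg fun p _ => hirr0 _ _ _)
  refine ⟨J, fun p hp => ?_, ?_⟩
  · by_contra hnot
    have h1 : (1 : ℝ) ≤ ∑ p ∈ upperPairs k, irr p (J p.1) (J p.2) := by
      have := Finset.single_le_sum (f := fun p : Fin k × Fin k => irr p (J p.1) (J p.2))
        (fun p _ => hirr0 _ _ _) hp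
      refine le_trans (le_of_eq ?_) this
      rw [hirr]
      simp [hnot]
    have h2 : 2 * (k : ℝ) ^ 2 * 1 ≤ 2 * (k : ℝ) ^ 2 * ∑ p ∈ upperPairs k, irr p (J p.1) (J p.2) := by
      gcongr
    linarith
  · rw [Finset.sum_add_distrib]
    linarith

end Averaging

/-! ### Edit distance bounded by the reduced distance -/

section EditUpperBound

lemma IsEquipartition.sum_card {ι : Type v} [Fintype ι] {α : Type u} [Fintype α]
    {V : ι → Finset α} (hV : IsEquipartition V) : ∑ i, (V i).card = Fintype.card α := by
  classical
  rw [← Finset.card_biUnion fun i _ j _ h => hV.disjoint i j h, ← Finset.card_univ]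
  congr 1
  ext x
  simpa using hV.cover x

lemma IsEquipartition.card_mul_le {ι : Type v} [Fintype ι] {α : Type u} [Fintype α]
    {V : ι → Finset α} (hV : IsEquipartition V) (i : ι) :
    (Fintype.card ι : ℝ) * ((V i).card - 1) ≤ Fintype.card α := by
  rw [← hV.sum_card]
  push_cast
  calc (Fintype.card ι : ℝ) * ((V i).card - 1) = ∑ j : ι, (((V i).card : ℝ) - 1) := by
        simp [mul_sub]
    _ ≤ _ := Finset.sum_le_sum fun j _ => by
      have : ((V i).card : ℝ) ≤ (V j).card + 1 := by exact_mod_cast hV.card_le i j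
      linarith

open Classical in
lemma sum_edgeWeight {k : ℕ} (W : WeightedCompleteGraph (Fin k)) (S : Finset (Sym2 (Fin k)))
    (hS : (S : Set (Sym2 (Fin k))) ⊆ (⊤ : SimpleGraph (Fin k)).edgeSet) :
    ∑ e ∈ S, W.edgeWeight e =
      ∑ p ∈ (upperPairs k).filter fun p => s(p.1, p.2) ∈ S, W.weight p.1 p.2 := by
  symm
  refine Finset.sum_nbij (fun p => s(p.1, p.2)) ?_ ?_ ?_ ?_
  · intro p hp
    exact (Finset.mem_filter.1 hp).2
  · rintro ⟨p, q⟩ hp ⟨p', q'⟩ hp' h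
    simp only [Finset.coe_filter, Set.mem_ofPred_eq, mem_upperPairs] at hp hp'
    simp only [Sym2.eq_iff] at h
    rcases h with ⟨rfl, rfl⟩ | ⟨rfl, rfl⟩
    · rfl
    · exact absurd hp.1 (lt_asymm hp'.1)
  · intro e he
    have hne := hS he
    induction e using Sym2.ind with
    | _ x y =>
      have hne : x ≠ y := by simpa using hne
      rcases hne.lt_or_gt with h | h
      · exact ⟨(x, y), by simpa [mem_upperPairs, h] using he, rfl⟩
      · exact ⟨(y, x), by simpa [mem_upperPairs, h, Sym2.eq_swap] using he, Sym2.eq_swap⟩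
  · intro p _
    rfl

/-- The normalized edit distance is at most the reduced one plus the part caused by the edges
inside the parts and by rounding. -/
theorem editDistFree_le_homDist_add {𝓕 : GraphFamily} {α : Type u} [Fintype α] (G : SimpleGraph α)
    [DecidableRel G.Adj] {k : ℕ} {V : Fin k → Finset α} (hV : IsEquipartition V) {ε : ℝ}
    (hε : 0 < ε) (hk : 1 / ε ≤ k) (hn : 6 * (k : ℝ) ^ 2 ≤ ε * Fintype.card α)
    (W : WeightedCompleteGraph (Fin k))
    (hW : ∀ i j, i ≠ j → W.weight i j = (G.edgeDensity (V i) (V j) : ℝ)) :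
    editDistFree 𝓕 G ≤ homDist 𝓕 W + (ε : EReal) := by
  classical
  rw [← EReal.sub_le_iff_le_add (Or.inl (EReal.coe_ne_bot _)) (Or.inl (EReal.coe_ne_top _))]
  refine le_iInf fun S => le_iInf fun hS => le_iInf fun hfree => ?_
  rw [EReal.sub_le_iff_le_add (Or.inl (EReal.coe_ne_bot _)) (Or.inl (EReal.coe_ne_top _)),
    ← EReal.coe_add]
  choose π hπ using hV.cover
  have hπ' : ∀ {x i}, x ∈ V i → π x = i := fun {x i} h => by
    by_contra hne
    exact Finset.disjoint_left.1 (hV.disjoint _ _ hne) (hπ x) h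
  let G' : SimpleGraph α :=
    { Adj := fun x y => G.Adj x y ∧ π x ≠ π y ∧ s(π x, π y) ∉ S
      symm := ⟨fun x y h => ⟨h.1.symm, h.2.1.symm, by rw [Sym2.eq_swap]; exact h.2.2⟩⟩
      loopless := ⟨fun x h => h.2.1 rfl⟩ }
  -- A copy of `F` in `G'`, composed with the part map `π`, would be a homomorphism to the reduced
  -- graph.
  have hG' : FamilyFree 𝓕 G' := by
    rintro F hF ⟨f⟩
    refine hfree F hF ⟨⟨fun v => π (f v), fun {a b} hab => ?_⟩⟩
    have : G'.Adj (f a) (f b) := f.toHom.map_adj hab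
    rw [SimpleGraph.deleteEdges_adj]
    exact ⟨this.2.1, this.2.2⟩
  refine (iInf₂_le G' hG').trans (EReal.coe_le_coe_iff.2 ?_)
  set R := (upperPairs k).filter fun p => s(p.1, p.2) ∈ S with hR
  have hsub : symmDiff G.edgeSet G'.edgeSet ⊆
      ((Finset.univ.biUnion fun i => (V i).offDiag.image Sym2.mk.uncurry) ∪
        R.biUnion fun p => (G.interedges (V p.1) (V p.2)).image Sym2.mk.uncurry : Finset (Sym2 α)) := by
    have hle : G' ≤ G := fun x y h => h.1
    rw [symmDiff_of_ge (SimpleGraph.edgeSet_subset_edgeSet.2 hle)]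
    intro e he
    induction e using Sym2.ind with
    | _ x y =>
      obtain ⟨h1, h2⟩ := he
      rw [SimpleGraph.mem_edgeSet] at h1 h2
      simp only [Finset.coe_union, Set.mem_union, Finset.mem_coe, Finset.mem_biUnion,
        Finset.mem_univ, true_and, Finset.mem_image, Finset.mem_offDiag, Prod.exists]
      by_cases hxy : π x = π y
      · exact Or.inl ⟨π x, x, y, ⟨hπ x, hxy ▸ hπ y, h1.ne⟩, rfl⟩
      · have hmem : s(π x, π y) ∈ S := by
          by_contra hmem
          exact h2 ⟨h1, hxy, hmem⟩
        right
        rcases Ne.lt_or_gt hxy with h | h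
        · exact ⟨π x, π y, by simp [hR, mem_upperPairs, h, hmem], x, y,
            (SimpleGraph.mem_interedges_iff G).2 ⟨hπ x, hπ y, h1⟩, rfl⟩
        · refine ⟨π y, π x, ?_, y, x,
            (SimpleGraph.mem_interedges_iff G).2 ⟨hπ y, hπ x, h1.symm⟩, Sym2.eq_swap⟩
          rw [Sym2.eq_swap] at hmem
          simp [hR, mem_upperPairs, h, hmem]
  have hcount : editDist G G' ≤ ∑ i, (V i).card.choose 2 +
      ∑ p ∈ R, (G.interedges (V p.1) (V p.2)).card := by
    unfold editDist
    refine (Set.ncard_le_ncard hsub (Finset.finite_toSet _)).trans ?_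
    rw [Set.ncard_coe_finset]
    refine (Finset.card_union_le _ _).trans (add_le_add ?_ ?_)
    · refine Finset.card_biUnion_le.trans (Finset.sum_le_sum fun i _ => ?_)
      rw [Sym2.card_image_offDiag]
    · exact Finset.card_biUnion_le.trans (Finset.sum_le_sum fun p _ => Finset.card_image_le)
  have hcount' : (editDist G G' : ℝ) ≤ ∑ i, ((V i).card.choose 2 : ℝ) +
      ∑ p ∈ R, ((G.interedges (V p.1) (V p.2)).card : ℝ) := by exact_mod_cast hcount
  set n : ℝ := (Fintype.card α : ℝ) with hn'
  have hkpos : (0 : ℝ) < k := lt_of_lt_of_le (by positivity) hk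
  have hk1 : (1 : ℝ) ≤ k := by
    have : 0 < k := by exact_mod_cast hkpos
    exact_mod_cast this
  have hnpos : 0 < n := by
    have : 0 < ε * n := lt_of_lt_of_le (by positivity) hn
    exact pos_of_mul_pos_right this hε.le
  have hsize : ∀ i, ((V i).card : ℝ) - 1 ≤ n / k := by
    intro i
    rw [le_div_iff₀ hkpos, mul_comm]
    simpa using hV.card_mul_le i
  have hεk : 1 ≤ ε * k := by rwa [div_le_iff₀' hε] at hk
  have hin : ∑ i, ((V i).card.choose 2 : ℝ) ≤ ε / 2 * n ^ 2 := by
    calc ∑ i, ((V i).card.choose 2 : ℝ) ≤ ∑ i, ((V i).card : ℝ) * (n / k / 2) :=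
          Finset.sum_le_sum fun i _ => by
            rw [Nat.cast_choose_two]
            have := mul_le_mul_of_nonneg_left (hsize i) ((V i).card.cast_nonneg (α := ℝ))
            linarith
      _ = n * (n / k / 2) := by
          rw [← Finset.sum_mul, hn', ← hV.sum_card]
          push_cast
          rfl
      _ ≤ _ := by
          have : n / k ≤ ε * n := by
            rw [div_le_iff₀ hkpos]
            nlinarith
          nlinarith
  -- The term `3 * n` is the rounding error for unequal parts; over at most `k ^ 2` pairs `hn`
  -- bounds it by `ε / 2 * n ^ 2`.
  have hprod : ∀ i j, ((V i).card : ℝ) * (V j).card ≤ n ^ 2 / (k : ℝ) ^ 2 + 3 * n := by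
    intro i j
    have h1 : ((V i).card : ℝ) ≤ n / k + 1 := by linarith [hsize i]
    have h2 : ((V j).card : ℝ) ≤ n / k + 1 := by linarith [hsize j]
    have h3 : n / k ≤ n := div_le_self hnpos.le hk1
    have hn1 : 1 ≤ n := by
      have : 0 < Fintype.card α := Nat.cast_pos.1 hnpos
      rw [hn']
      exact_mod_cast this
    calc ((V i).card : ℝ) * (V j).card ≤ (n / k + 1) * (n / k + 1) := by gcongr
      _ = n ^ 2 / (k : ℝ) ^ 2 + 2 * (n / k) + 1 := by ring
      _ ≤ _ := by linarith
  have hcross : ∑ p ∈ R, ((G.interedges (V p.1) (V p.2)).card : ℝ) ≤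
      (∑ e ∈ S, W.edgeWeight e) / (k : ℝ) ^ 2 * n ^ 2 + ε / 2 * n ^ 2 := by
    rw [sum_edgeWeight W S hS, ← hR]
    calc ∑ p ∈ R, ((G.interedges (V p.1) (V p.2)).card : ℝ)
        ≤ ∑ p ∈ R, (W.weight p.1 p.2 * (n ^ 2 / (k : ℝ) ^ 2) + 3 * n) := by
          refine Finset.sum_le_sum fun p hp => ?_
          have hlt : p.1 < p.2 := mem_upperPairs.1 (Finset.mem_filter.1 hp).1
          have hw := W.mem_Icc p.1 p.2 hlt.ne
          have h1 : (0 : ℝ) < (V p.1).card := by exact_mod_cast (hV.nonempty p.1).card_pos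
          have h2 : (0 : ℝ) < (V p.2).card := by exact_mod_cast (hV.nonempty p.2).card_pos
          have h3 : ((G.interedges (V p.1) (V p.2)).card : ℝ) =
              W.weight p.1 p.2 * ((V p.1).card * (V p.2).card) := by
            rw [hW _ _ hlt.ne, SimpleGraph.edgeDensity_def]
            push_cast
            rw [div_mul_cancel₀ _ (by positivity)]
          rw [h3]
          calc _ ≤ W.weight p.1 p.2 * (n ^ 2 / (k : ℝ) ^ 2 + 3 * n) :=
                mul_le_mul_of_nonneg_left (hprod _ _) hw.1
            _ ≤ _ := by
                rw [mul_add]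
                have := mul_le_mul_of_nonneg_right hw.2 (by positivity : 0 ≤ 3 * n)
                linarith
      _ = (∑ p ∈ R, W.weight p.1 p.2) / (k : ℝ) ^ 2 * n ^ 2 + R.card * (3 * n) := by
          rw [Finset.sum_add_distrib, ← Finset.sum_mul]
          simp only [Finset.sum_const, nsmul_eq_mul]
          ring
      _ ≤ _ := by
          have hRc : (R.card : ℝ) ≤ (k : ℝ) ^ 2 := le_trans
            (by exact_mod_cast Finset.card_le_card (Finset.filter_subset _ _)) (card_upperPairs_le k)
          have : (R.card : ℝ) * (3 * n) ≤ (k : ℝ) ^ 2 * (3 * n) := by gcongr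
          nlinarith
  rw [Fintype.card_fin, div_le_iff₀ (by positivity), add_mul]
  linarith

end EditUpperBound

/-! ### Reduced distance bounded by the edit distance -/

section EditLowerBound

/-- The graph on the indices of the sets `W i` in which dense pairs are adjacent. -/
def denseGraph {α : Type u} {ι : Type v} (H : SimpleGraph α) (δ : ℝ) (W : ι → Finset α) :
    SimpleGraph ι where
  Adj p q := p ≠ q ∧ δ ≤ dens (adjInd H) (W p) (W q)
  symm := ⟨fun p q h => ⟨h.1.symm, dens_comm (adjInd_comm H) (W p) (W q) ▸ h.2⟩⟩
  loopless := ⟨fun _ h => h.1 rfl⟩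

/-- A homomorphism `φ : F → K` would give `v` the candidate set `W (φ v)`, and greedy embedding
would find `F` in `H`. One such `F` is fixed for each of the finitely many bad `K`, so `a` depends
only on `𝓕`, `d` and `k`. -/
lemma familyHomFree_of_lower_regular (𝓕 : GraphFamily) {d : ℝ} (hd : 0 < d) (hd1 : d ≤ 1)
    (k : ℕ) :
    ∃ a : ℝ, 1 ≤ a ∧ ∀ {α : Type u} (H : SimpleGraph α) (K : SimpleGraph (Fin k))
      (W : Fin k → Finset α), FamilyFree 𝓕 H → (∀ i, a ≤ (W i).card) →
      (∀ p q, K.Adj p q → ∀ A B, A ⊆ W p → B ⊆ W q → a⁻¹ * (W p).card ≤ A.card →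
        a⁻¹ * (W q).card ≤ B.card → d ≤ dens (adjInd H) A B) →
      FamilyHomFree 𝓕 K := by
  classical
  have hK : ∀ K : SimpleGraph (Fin k), ∃ a : ℝ, 1 ≤ a ∧ ∀ {α : Type u} (H : SimpleGraph α)
      (W : Fin k → Finset α), FamilyFree 𝓕 H → (∀ i, a ≤ (W i).card) →
      (∀ p q, K.Adj p q → ∀ A B, A ⊆ W p → B ⊆ W q → a⁻¹ * (W p).card ≤ A.card →
        a⁻¹ * (W q).card ≤ B.card → d ≤ dens (adjInd H) A B) →
      FamilyHomFree 𝓕 K := by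
    intro K
    by_cases hfree : FamilyHomFree 𝓕 K
    · exact ⟨1, le_rfl, fun _ _ _ _ _ => hfree⟩
    unfold FamilyHomFree at hfree
    push Not at hfree
    obtain ⟨F, hF, ⟨φ⟩⟩ := hfree
    obtain ⟨a, ha, hemb⟩ := exists_greedy_embedding.{u} hd hd1 F.1
    have ha0 : 0 < a := by linarith
    refine ⟨a, ha, fun H W hH hW hdens => ?_⟩
    obtain ⟨f, hinj, -, hadj⟩ := hemb F.2 H (fun v => W (φ v)) (fun v => a⁻¹ * (W (φ v)).card)
      (fun v => by
        rw [inv_mul_eq_div, le_div_iff₀ ha0, one_mul]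
        exact hW _)
      (fun v => by rw [mul_inv_cancel_left₀ ha0.ne'])
      fun u v huv => hdens _ _ (φ.map_adj huv)
    exact absurd ⟨⟨⟨f, fun {u v} huv => hadj u v huv⟩, hinj⟩⟩ (hH F hF)
  choose a ha hK using hK
  have hle : ∀ K, a K ≤ ∑ K, a K := fun K =>
    Finset.single_le_sum (fun K _ => by linarith [ha K]) (Finset.mem_univ K)
  refine ⟨∑ K, a K, (ha ⊥).trans (hle ⊥), fun H K W hH hW hdens => ?_⟩
  refine hK K H W hH (fun i => (hle K).trans (hW i)) fun p q hpq A B hA hB hAc hBc =>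
    hdens p q hpq A B hA hB (le_trans ?_ hAc) (le_trans ?_ hBc)
  all_goals
    refine mul_le_mul_of_nonneg_right (inv_anti₀ ?_ (hle K)) (Nat.cast_nonneg _)
    linarith [ha K]

/-- In a host graph free of the family, any tuple of large sets has a tuple of large subsets whose
graph of dense pairs admits no homomorphism from the family; their total density in any other
given graph has not increased much. -/
lemma exists_denseGraph_homFree (𝓕 : GraphFamily) {c δ : ℝ} (hc : 0 < c) (hδ : 0 < δ)
    (hδ1 : δ ≤ 1) (k : ℕ) :
    ∃ η a : ℝ, 0 < η ∧ 1 ≤ a ∧ ∀ {α : Type u} [Fintype α] (H D : SimpleGraph α)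
      (U : Fin k → Finset α), FamilyFree 𝓕 H → (∀ i, a ≤ η * (U i).card) →
      ∃ W : Fin k → Finset α, (∀ i, W i ⊆ U i) ∧ (∀ i, η * (U i).card ≤ (W i).card) ∧
        ∑ p ∈ upperPairs k, dens (adjInd D) (W p.1) (W p.2) ≤
          ∑ p ∈ upperPairs k, dens (adjInd D) (U p.1) (U p.2) + c * (k : ℝ) ^ 2 ∧
        FamilyHomFree 𝓕 (denseGraph H δ W) := by
  obtain ⟨a, ha, hfree⟩ := familyHomFree_of_lower_regular.{u} 𝓕 (half_pos hδ)
    (by linarith : δ / 2 ≤ 1) k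
  have ha0 : 0 < a := by linarith
  have hγ : 0 < a⁻¹ := inv_pos.2 ha0
  have hγ' : 0 < 1 + 1 / a⁻¹ := by positivity
  -- Half of the largest value of `t` allowed by the regularity condition.
  set t := c * a⁻¹ * (δ / 4) ^ 2 / (2 * (1 + 1 / a⁻¹)) with ht
  have htpos : 0 < t := by positivity
  have htγ : t * (1 + 1 / a⁻¹) < c * a⁻¹ * (δ / 4) ^ 2 := by
    have h0 : 0 < c * a⁻¹ * (δ / 4) ^ 2 := by positivity
    have : t * (1 + 1 / a⁻¹) = c * a⁻¹ * (δ / 4) ^ 2 / 2 := by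
      rw [ht]
      generalize 1 + 1 / a⁻¹ = y at *
      field_simp
    linarith
  refine ⟨Real.exp (-((1 + c) * (k : ℝ) ^ 2 / t)), a, Real.exp_pos _, ha,
    fun {α} _ H D U hH hU => ?_⟩
  have hUne : ∀ i, (U i).Nonempty := by
    intro i
    rw [Finset.nonempty_iff_ne_empty]
    intro hi
    have := hU i
    rw [hi] at this
    simp only [Finset.card_empty, Nat.cast_zero, mul_zero] at this
    linarith
  obtain ⟨W, hWU, -, hWc, hsum, hreg⟩ := exists_lower_regular (P := upperPairs k)
    (fun p hp => (mem_upperPairs.1 hp).ne) (adjInd_comm D) (adjInd_comm H) (adjInd_nonneg D)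
    (adjInd_le_one D) (adjInd_nonneg H) (adjInd_le_one H) hc htpos hγ hδ htγ U hUne
  have hP := card_upperPairs_le k
  have hWc' : ∀ i, Real.exp (-((1 + c) * (k : ℝ) ^ 2 / t)) * (U i).card ≤ (W i).card := by
    intro i
    refine le_trans ?_ (hWc i)
    gcongr
  refine ⟨W, hWU, hWc', hsum.trans (by gcongr), hfree H _ W hH (fun i => (hU i).trans (hWc' i)) ?_⟩
  intro p q hpq A B hA hB hAc hBc
  rcases hpq.1.lt_or_gt with h | h
  · exact hreg (p, q) (mem_upperPairs.2 h) hpq.2 A B hA hB hAc hBc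
  · rw [dens_comm (adjInd_comm H)]
    exact hreg (q, p) (mem_upperPairs.2 h) hpq.symm.2 B A hB hA hBc hAc

lemma dens_adjInd_le_sdiff_add {α : Type u} (G G' : SimpleGraph α) (A B : Finset α) :
    dens (adjInd G) A B ≤ dens (adjInd (G \ G')) A B + dens (adjInd G') A B := by
  unfold dens
  rw [← add_div, ← Finset.sum_add_distrib]
  refine div_le_div_of_nonneg_right (Finset.sum_le_sum fun x _ => ?_) (by positivity)
  rw [← Finset.sum_add_distrib]
  refine Finset.sum_le_sum fun y _ => ?_
  by_cases h : G.Adj x y <;> by_cases h' : G'.Adj x y <;> simp [adjInd, h, h']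

/-- The weight outside of the dense graph of a tuple of subsets of a transversal is controlled by
the total density of the removed edges. -/
lemma sum_weight_le {α : Type u} {G G' : SimpleGraph α} [DecidableRel G.Adj] {k : ℕ}
    {V U X : Fin k → Finset α} {γ₀ γ δ : ℝ} (hγ₀ : 0 ≤ γ₀) (hγ : 0 ≤ γ) (hδ : 0 ≤ δ)
    (hreg : ∀ p ∈ upperPairs k, IsRegularPair G γ (U p.1) (U p.2))
    (hXU : ∀ i, X i ⊆ U i) (hX : ∀ i, γ * (U i).card ≤ (X i).card)
    {R : Finset (Fin k × Fin k)} (hR : ∀ p ∈ R, p ∈ upperPairs k)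
    (hRδ : ∀ p ∈ R, dens (adjInd G') (X p.1) (X p.2) ≤ δ)
    (W : WeightedCompleteGraph (Fin k))
    (hW : ∀ i j, i ≠ j → W.weight i j = (G.edgeDensity (V i) (V j) : ℝ)) [DecidablePred
      fun p : Fin k × Fin k => DensityDeviates G γ₀ (V p.1) (V p.2) (U p.1) (U p.2)] :
    ∑ p ∈ R, W.weight p.1 p.2 ≤
      ∑ p ∈ upperPairs k, dens (adjInd (G \ G')) (X p.1) (X p.2) +
      ∑ p ∈ upperPairs k,
        (if DensityDeviates G γ₀ (V p.1) (V p.2) (U p.1) (U p.2) then (1 : ℝ) else 0) +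
      (γ₀ + γ + δ) * (k : ℝ) ^ 2 := by
  have hdev : ∀ p : Fin k × Fin k, (0 : ℝ) ≤
      if DensityDeviates G γ₀ (V p.1) (V p.2) (U p.1) (U p.2) then 1 else 0 := fun p => by
    split_ifs <;> norm_num
  have hterm : ∀ p ∈ R, W.weight p.1 p.2 ≤ dens (adjInd (G \ G')) (X p.1) (X p.2) +
      (if DensityDeviates G γ₀ (V p.1) (V p.2) (U p.1) (U p.2) then 1 else 0) +
      (γ₀ + γ + δ) := by
    intro p hp
    have hne := (mem_upperPairs.1 (hR p hp)).ne
    have hnn := dens_nonneg (adjInd_nonneg (G \ G')) (X p.1) (X p.2)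
    by_cases hd : DensityDeviates G γ₀ (V p.1) (V p.2) (U p.1) (U p.2)
    -- A deviating pair is charged its maximal weight `1`. For any other pair the weight is compared
    -- with the cell density at cost `γ₀`, and with the density on the subsets at cost `γ` by
    -- regularity.
    · rw [if_pos hd]
      linarith [(W.mem_Icc _ _ hne).2]
    · rw [if_neg hd]
      unfold DensityDeviates at hd
      have h1 := (abs_lt.1 (not_not.1 hd)).2
      have h2 := (abs_le.1 (hreg p (hR p hp) _ _ (hXU _) (hXU _) (hX _) (hX _))).1
      rw [edgeDensity_eq_dens, edgeDensity_eq_dens] at h2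
      have h3 := dens_adjInd_le_sdiff_add G G' (X p.1) (X p.2)
      rw [hW _ _ hne, edgeDensity_eq_dens]
      linarith [hRδ p hp]
  calc _ ≤ _ := Finset.sum_le_sum hterm
    _ ≤ ∑ p ∈ upperPairs k, (dens (adjInd (G \ G')) (X p.1) (X p.2) +
      (if DensityDeviates G γ₀ (V p.1) (V p.2) (U p.1) (U p.2) then (1 : ℝ) else 0) +
      (γ₀ + γ + δ)) := Finset.sum_le_sum_of_subset_of_nonneg hR fun p _ _ => by
        have hnn := dens_nonneg (adjInd_nonneg (G \ G')) (X p.1) (X p.2)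
        linarith [hdev p]
    _ ≤ _ := by
        rw [Finset.sum_add_distrib, Finset.sum_add_distrib]
        simp only [Finset.sum_const, nsmul_eq_mul]
        have := card_upperPairs_le k
        have : ((upperPairs k).card : ℝ) * (γ₀ + γ + δ) ≤ (k : ℝ) ^ 2 * (γ₀ + γ + δ) := by gcongr
        linarith

lemma ncard_edgeSet_sdiff_le {α : Type u} [Fintype α] (G G' : SimpleGraph α) :
    (G \ G').edgeSet.ncard ≤ editDist G G' := by
  unfold editDist
  refine Set.ncard_le_ncard ?_ (Set.toFinite _)
  rw [SimpleGraph.edgeSet_sdiff]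
  exact fun e he => Or.inl he

lemma ncard_edgeSet_le {α : Type u} [Fintype α] (D : SimpleGraph α) :
    (D.edgeSet.ncard : ℝ) ≤ (Fintype.card α : ℝ) ^ 2 := by
  classical
  rw [← SimpleGraph.coe_edgeFinset, Set.ncard_coe_finset]
  exact_mod_cast D.card_edgeFinset_le_card_choose_two.trans (Nat.choose_le_pow _ _)

/-- Comparison of the average over the parts of the refinement with the normalized number of
edges. -/
lemma ncard_edgeSet_div_le {α : Type u} [Fintype α] (D : SimpleGraph α) {k l m : ℕ} {e : ℝ}
    {U : Fin k → Fin l → Finset α}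
    (hU : IsEquipartition fun p : Fin k × Fin l => U p.1 p.2) (hl : 0 < l) (hm : 0 < m)
    (hn : 0 < Fintype.card α)
    (hUm : ∀ i j, (U i j).card ≤ m + 1) (he : 3 ≤ e * m) :
    (D.edgeSet.ncard : ℝ) / ((l : ℝ) ^ 2 * (m : ℝ) ^ 2) ≤
      (k : ℝ) ^ 2 * ((D.edgeSet.ncard : ℝ) / (Fintype.card α : ℝ) ^ 2 + e) := by
  have hD := ncard_edgeSet_le D
  have hD0 : (0 : ℝ) ≤ D.edgeSet.ncard := Nat.cast_nonneg _
  have hcard : (Fintype.card α : ℝ) ≤ k * l * (m + 1) := by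
    rw [← hU.sum_card]
    push_cast
    calc ∑ p : Fin k × Fin l, ((U p.1 p.2).card : ℝ) ≤ ∑ p : Fin k × Fin l, ((m : ℝ) + 1) :=
          Finset.sum_le_sum fun p _ => by exact_mod_cast hUm _ _
      _ = _ := by simp; ring
  have hn' : (0 : ℝ) < Fintype.card α := by exact_mod_cast hn
  have hl' : (0 : ℝ) < l := by exact_mod_cast hl
  have hm' : (1 : ℝ) ≤ m := by exact_mod_cast hm
  generalize (Fintype.card α : ℝ) = n at *
  generalize (D.edgeSet.ncard : ℝ) = x at *
  generalize (m : ℝ) = m at *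
  generalize (l : ℝ) = l at *
  generalize (k : ℝ) = k at *
  have hm0 : 0 < m := by linarith
  have hsq : n ^ 2 ≤ (k * l * (m + 1)) ^ 2 := pow_le_pow_left₀ hn'.le hcard 2
  -- Here `2 * m + 1 ≤ 3 * m ≤ e * m ^ 2`.
  have h1 : (m + 1) ^ 2 ≤ m ^ 2 * (1 + e) := by nlinarith
  have h2 : n ^ 2 ≤ k ^ 2 * (l ^ 2 * m ^ 2) * (1 + e) := by
    calc n ^ 2 ≤ k ^ 2 * l ^ 2 * (m + 1) ^ 2 := by linarith
      _ ≤ k ^ 2 * l ^ 2 * (m ^ 2 * (1 + e)) := by gcongr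
      _ = _ := by ring
  have h3 : x / n ^ 2 ≤ 1 := div_le_one_of_le₀ hD (by positivity)
  have he0 : 0 < e := by
    by_contra! h
    nlinarith
  calc x / (l ^ 2 * m ^ 2) = (x / n ^ 2) * (n ^ 2 / (l ^ 2 * m ^ 2)) := by field_simp
    _ ≤ (x / n ^ 2) * (k ^ 2 * (1 + e)) := by
        gcongr
        rw [div_le_iff₀ (by positivity)]
        linarith
    _ = k ^ 2 * (x / n ^ 2 + x / n ^ 2 * e) := by ring
    _ ≤ k ^ 2 * (x / n ^ 2 + 1 * e) := by gcongr
    _ = _ := by rw [one_mul]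

open Classical in
/-- The reduced distance is at most the normalized edit distance plus a small error. -/
theorem homDist_le_editDistFree_add {e : ℝ} (he : 0 < e) (he1 : e ≤ 1) (𝓕 : GraphFamily) :
    ∃ (N : ℕ → ℕ) (ℰ : ℕ → ℝ), (∀ r, ℰ r ∈ Set.Ioo (0 : ℝ) 1) ∧
      ∀ {α : Type u} [Fintype α] (G : SimpleGraph α) [DecidableRel G.Adj] {k l : ℕ}
        {V : Fin k → Finset α} {U : Fin k → Fin l → Finset α},
        IsRegularEquipartitionPair G ℰ V U → 0 < k → (∀ i j, N k ≤ (U i j).card) →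
        ∀ W : WeightedCompleteGraph (Fin k),
          (∀ i j, i ≠ j → W.weight i j = (G.edgeDensity (V i) (V j) : ℝ)) →
          homDist 𝓕 W ≤ editDistFree 𝓕 G + (e : EReal) := by
  choose η a hη ha hdense using exists_denseGraph_homFree.{u} 𝓕 (c := e / 8) (δ := e / 8)
    (by linarith) (by linarith) (by linarith)
  -- In `N`, the first term makes the subsets large enough for embedding and the second makes
  -- rounding of cell sizes negligible. In `ℰ`, the bound `η k` lets regularity apply to the
  -- subsets, and the last bound keeps the penalty `2 * k ^ 4 * ℰ k` below `k ^ 2 * e / 16`.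
  refine ⟨fun k => ⌈a k / η k⌉₊ + ⌈48 / e⌉₊ + 1,
    fun k => min (e / 16) (min (η k) (e / (32 * ((k : ℝ) ^ 2 + 1)))), fun r => ⟨?_, ?_⟩, ?_⟩
  · have := hη r
    positivity
  · exact (min_le_left _ _).trans_lt (by linarith)
  set ℰ : ℕ → ℝ := fun k => min (e / 16) (min (η k) (e / (32 * ((k : ℝ) ^ 2 + 1)))) with hℰ
  have hℰpos : ∀ r, 0 ≤ ℰ r := fun r => by
    have := hη r
    positivity
  have hℰ1 : ∀ r, ℰ r ≤ e / 16 := fun r => min_le_left _ _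
  have hℰ2 : ∀ r, ℰ r ≤ η r := fun r => (min_le_right _ _).trans (min_le_left _ _)
  have hℰ3 : ∀ r, ℰ r ≤ e / (32 * ((r : ℝ) ^ 2 + 1)) := fun r =>
    (min_le_right _ _).trans (min_le_right _ _)
  clear_value ℰ
  intro α _ G _ k l V U hpair hk hN W hW
  rw [← EReal.sub_le_iff_le_add (Or.inl (EReal.coe_ne_bot _)) (Or.inl (EReal.coe_ne_top _))]
  refine le_iInf fun G' => le_iInf fun hG' => ?_
  rw [EReal.sub_le_iff_le_add (Or.inl (EReal.coe_ne_bot _)) (Or.inl (EReal.coe_ne_top _)),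
    ← EReal.coe_add]
  obtain ⟨x₀, -⟩ := hpair.equipartition.nonempty ⟨0, hk⟩
  have hn : 0 < Fintype.card α := Fintype.card_pos_iff.2 ⟨x₀⟩
  obtain ⟨⟨i₀, j₀⟩, -⟩ := hpair.equipartition_refinement.cover x₀
  have hl : 0 < l := j₀.pos
  obtain ⟨⟨i₁, j₁⟩, -, hmin⟩ := Finset.exists_min_image (Finset.univ : Finset (Fin k × Fin l))
    (fun p => (U p.1 p.2).card) ⟨(i₀, j₀), Finset.mem_univ _⟩
  set m := (U i₁ j₁).card with hm
  have hUm : ∀ i j, m ≤ (U i j).card := fun i j => hmin (i, j) (Finset.mem_univ _)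
  have hUm' : ∀ i j, (U i j).card ≤ m + 1 := fun i j =>
    hpair.equipartition_refinement.card_le (i, j) (i₁, j₁)
  have hmN : ⌈a k / η k⌉₊ + ⌈48 / e⌉₊ + 1 ≤ m := hN i₁ j₁
  have hmpos : 0 < m := by omega
  have hme : 48 / e ≤ m := (Nat.le_ceil _).trans (by exact_mod_cast (by omega : ⌈48 / e⌉₊ ≤ m))
  have hma : a k / η k ≤ m := (Nat.le_ceil _).trans
    (by exact_mod_cast (by omega : ⌈a k / η k⌉₊ ≤ m))
  have hkR : (1 : ℝ) ≤ k := by exact_mod_cast hk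
  set D := G \ G' with hD
  set x : ℝ := (D.edgeSet.ncard : ℝ) / (Fintype.card α : ℝ) ^ 2 with hx
  have hx1 : x ≤ 1 := div_le_one_of_le₀ (ncard_edgeSet_le D) (by positivity)
  have hxdist : x ≤ (editDist G G' : ℝ) / (Fintype.card α : ℝ) ^ 2 := by
    have : (D.edgeSet.ncard : ℝ) ≤ editDist G G' := by exact_mod_cast ncard_edgeSet_sdiff_le G G'
    rw [hx]
    gcongr
  have havg := ncard_edgeSet_div_le D (e := e / 16) hpair.equipartition_refinement hl hmpos hn hUm'
    (by rw [div_le_iff₀ he] at hme; linarith)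
  have hℰk : 2 * (k : ℝ) ^ 4 * ℰ k ≤ (k : ℝ) ^ 2 * (e / 16) := by
    have h1 := hℰ3 k
    rw [le_div_iff₀ (by positivity)] at h1
    have h2 : (k : ℝ) ^ 2 * ℰ k * 32 ≤ e := by linarith [hℰpos k]
    calc 2 * (k : ℝ) ^ 4 * ℰ k = (k : ℝ) ^ 2 * ((k : ℝ) ^ 2 * ℰ k * 32 / 16) := by ring
      _ ≤ _ := by gcongr
  have hk2 : (0 : ℝ) < (k : ℝ) ^ 2 := by positivity
  have hℰ0 : 2 * ℰ 0 * (k : ℝ) ^ 2 ≤ (k : ℝ) ^ 2 * (e / 8) := by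
    have := mul_le_mul_of_nonneg_left (hℰ1 0) hk2.le
    linarith
  -- The errors are `e / 16` for rounding, `e / 8` for deviation and `e / 16` for irregularity. As
  -- `x, e ≤ 1`, the total stays below the `2 * k ^ 2` that `exists_transversal` needs.
  have hbound : (D.edgeSet.ncard : ℝ) / ((l : ℝ) ^ 2 * (m : ℝ) ^ 2) + 2 * ℰ 0 * (k : ℝ) ^ 2
      + 2 * (k : ℝ) ^ 4 * ℰ k ≤ (k : ℝ) ^ 2 * (x + e / 4) := by linarith
  obtain ⟨J, hJreg, hJsum⟩ := exists_transversal (D := D) hpair hl hmpos hUm (hℰpos 0) (hℰpos k)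
    (hbound.trans_lt (by nlinarith))
  rw [Finset.sum_add_distrib] at hJsum
  obtain ⟨X, hXU, hXc, hXsum, hXfree⟩ := hdense k G' D (fun i => U i (J i)) hG' fun i => by
    rw [← div_le_iff₀' (hη k)]
    exact hma.trans (by exact_mod_cast hUm _ _)
  set K := denseGraph G' (e / 8) X with hK
  -- All pairs that are not dense in `G'` are removed, which leaves exactly `K`.
  set S : Finset (Sym2 (Fin k)) :=
    Finset.univ.filter fun z => z ∈ (⊤ : SimpleGraph (Fin k)).edgeSet ∧ z ∉ K.edgeSet with hS
  have hStop : (S : Set (Sym2 (Fin k))) ⊆ (⊤ : SimpleGraph (Fin k)).edgeSet := fun z hz =>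
    (Finset.mem_filter.1 hz).2.1
  have hSK : (⊤ : SimpleGraph (Fin k)).deleteEdges (S : Set (Sym2 (Fin k))) = K := by
    ext p q
    rw [SimpleGraph.deleteEdges_adj]
    simp only [hS, Finset.coe_filter, Finset.mem_univ, true_and, Set.mem_ofPred_eq,
      SimpleGraph.mem_edgeSet, SimpleGraph.top_adj, not_and, not_not]
    exact ⟨fun h => h.2 h.1, fun h => ⟨h.ne, fun _ => h⟩⟩
  have hcost := sum_weight_le (G' := G') (γ₀ := ℰ 0) (δ := e / 8)
    (R := (upperPairs k).filter fun p => s(p.1, p.2) ∈ S) (hℰpos 0) (hℰpos k)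
    (by linarith) hJreg hXU
    (fun i => (mul_le_mul_of_nonneg_right (hℰ2 k) (Nat.cast_nonneg _)).trans (hXc i))
    (fun p hp => (Finset.mem_filter.1 hp).1) (fun p hp => by
      obtain ⟨h1, h2⟩ := Finset.mem_filter.1 hp
      have h3 := (Finset.mem_filter.1 h2).2.2
      by_contra! h4
      exact h3 ⟨(mem_upperPairs.1 h1).ne, h4.le⟩) W hW
  refine (iInf_le_of_le S (iInf₂_le hStop (hSK ▸ hXfree))).trans (EReal.coe_le_coe_iff.2 ?_)
  rw [sum_edgeWeight W S hStop, Fintype.card_fin, div_le_iff₀ hk2]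
  have h5 : (x + e) * (k : ℝ) ^ 2 ≤
      ((editDist G G' : ℝ) / (Fintype.card α : ℝ) ^ 2 + e) * (k : ℝ) ^ 2 := by gcongr
  refine le_trans ?_ h5
  have h6 : (ℰ 0 + ℰ k + e / 8) * (k : ℝ) ^ 2 ≤ (e / 16 + e / 16 + e / 8) * (k : ℝ) ^ 2 := by
    gcongr
    · exact hℰ1 0
    · exact hℰ1 k
  have h7 : 0 ≤ e * (k : ℝ) ^ 2 := by positivity
  linarith

end EditLowerBound

end EdgeDeletion

/-! ### Combining the two bounds -/

theorem lemma3p4 (ε : ℝ) (hε : 0 < ε) (𝓕 : EdgeDeletion.GraphFamily) :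
    ∃ (N : ℕ → ℕ) (ℰ : ℕ → ℝ), (∀ r, ℰ r ∈ Set.Ioo (0 : ℝ) 1) ∧
      ∀ (α : Type u) [Fintype α] (G : SimpleGraph α) [DecidableRel G.Adj] (k l : ℕ)
        (V : Fin k → Finset α) (U : Fin k → Fin l → Finset α),
        EdgeDeletion.IsRegularEquipartitionPair G ℰ V U →
        1 / ε ≤ (k : ℝ) →
        (∀ i j, N k ≤ (U i j).card) →
        ∀ W : EdgeDeletion.WeightedCompleteGraph (Fin k),
          (∀ i j, i ≠ j → W.weight i j = (G.edgeDensity (V i) (V j) : ℝ)) →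
          EdgeDeletion.editDistFree 𝓕 G ≤ EdgeDeletion.homDist 𝓕 W + (ε : EReal) ∧
          EdgeDeletion.homDist 𝓕 W ≤ EdgeDeletion.editDistFree 𝓕 G + (ε : EReal) := by
  -- The lower bound needs an error of at most `1`, hence `min ε 1`. The term added to `N` below
  -- forces `6 * k ^ 2 ≤ ε * n`, since a single cell is already that large.
  obtain ⟨N, ℰ, hℰ, h⟩ := EdgeDeletion.homDist_le_editDistFree_add.{u}
    (lt_min hε one_pos) (min_le_right ε 1) 𝓕
  refine ⟨fun k => N k + ⌈6 * (k : ℝ) ^ 2 / ε⌉₊, ℰ, hℰ, ?_⟩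
  intro α _ G _ k l V U hpair hk hN W hW
  have hkpos : 0 < k := by
    have : (0 : ℝ) < k := lt_of_lt_of_le (by positivity) hk
    exact_mod_cast this
  constructor
  · refine EdgeDeletion.editDistFree_le_homDist_add G hpair.equipartition hε hk ?_ W hW
    obtain ⟨x, -⟩ := hpair.equipartition.nonempty ⟨0, hkpos⟩
    obtain ⟨⟨i, j⟩, -⟩ := hpair.equipartition_refinement.cover x
    have h1 : ⌈6 * (k : ℝ) ^ 2 / ε⌉₊ ≤ Fintype.card α :=
      (Nat.le_add_left _ _).trans ((hN i j).trans (Finset.card_le_univ _))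
    rw [← div_le_iff₀' hε]
    exact Nat.ceil_le.1 h1
  · refine (h G hpair hkpos (fun i j => (Nat.le_add_right _ _).trans (hN i j)) W hW).trans ?_
    gcongr
    exact_mod_cast min_le_left ε 1
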